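/- **Setting.** Let $\Lambda$ be a finite connected simplicial complex. Fix a maximal tree $T\subset\Lambda$, a root vertex $i_0$, and a partial order on the vertices that is total on the vertices of each simplex. Let $\Gamma\cong\pi_1(|\Lambda|)$ be the edge-path group $E(\Lambda,i_0)$. Let $\mathbb F_\Lambda$ be the free group on the oriented edges $\langle i,j\rangle$ (with $\langle i,i\rangle$ allowed). For each edge let $\gamma_{ij}\in\Gamma$ be the class of the loop that runs from $i_0$ to $i$ along $T$, crosses $\langle i,j\rangle$, and returns to $i_0$ along $T$. Let $q:\mathbb F_\Lambda\to\Gamma$ be the homomorphism with $q(\langle i,j\rangle)=\gamma_{ij}$, and let $\mathcal F_\Lambda=\{\gamma_{ij}\}$. Fix a map $s:\Gamma\to\mathbb F_\Lambda$ with $q\circ s=\mathrm{id}$ and $s(e)=e$. For a unital $C^*$-algebra $A$ put $U(A)_\delta=\{a\in A:\operatorname{dist}(a,U(A))<\delta\}$. In barycentric coordinates $t$, let $c_i=\{t\in|\Lambda| : t_i\ge t_j\ \forall j\}$ be the dual cell of the vertex $i$, let $c_{ij}=c_i\cap c_j$ and $c_{ijk}=c_i\cap c_j\cap c_k$, and write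 $c_{ij}^\sigma$ for the part of $c_{ij}$ in a simplex $\sigma\ni i,j$. *Coordinate bundles.* A $GL(A)$-coordinate bundle is a family $\mathbf v$ of continuous maps $v_{ij}:c_{ij}\to GL(A)$, one for each 1-simplex $\langle i,j\rangle$ in either orientation, with $v_{ij}=v_{ji}^{-1}$ on $c_{ij}$, and $v_{ik}=v_{ij}v_{jk}$ on $c_{ijk}$ for every 2-simplex $\langle i,j,k\rangle$. It is $\varepsilon$-flat if $v_{ij}(x)\in U(A)_\varepsilon$ and $\|v_{ij}(x)-v_{ij}(y)\|<\varepsilon$ for all edges and all $x,y\in c_{ij}$. Write $\hat v_{ij}$ for the value of $v_{ij}$ at the barycenter of $\langle i,j\rangle$, and put $\hat v_{ii}=1$. The bundle is normalized if $\hat v_{ij}=1_A$ for every edge of $T$. Put $d(\mathbf v,\mathbf v')=\max_{\langle i,j\rangle}\max_{x\in c_{ij}}\|v_{ij}(x)-v'_{ij}(x)\|$. *Quasi-representations.* An $(\mathcal F_\Lambda,\delta)$-representation is a map $\pi:\Gamma\to GL(A)$ with $\pi(e)=1$, with $\pi(\gamma)\in U(A)_\delta$ for $\gamma\in\mathcal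 F_\Lambda$, and with $\|\pi(\gamma\gamma')-\pi(\gamma)\pi(\gamma')\|<\delta$ for $\gamma,\gamma'\in\mathcal F_\Lambda$. Put $d(\pi,\pi')=\max_{\gamma\in\mathcal F_\Lambda}\|\pi(\gamma)-\pi'(\gamma)\|$. *The map $\alpha$.* Let $\hat v_I$ be the product of the values $\hat v_{kl}$ along an edge path $I$. Let $\tilde\pi_{\mathbf v}:\mathbb F_\Lambda\to GL(A)$ be the homomorphism with $\tilde\pi_{\mathbf v}(\langle i,j\rangle)=\hat v_I\,\hat v_{ij}\,\hat v_J^{-1}$, where $I,J$ are the paths in $T$ from $i_0$ to $i$ and to $j$. Then $\alpha(\mathbf v)=\tilde\pi_{\mathbf v}\circ s$. *The map $\beta$.* Let $\breve\pi(\gamma)=\omega\big(\tfrac12(\pi(\gamma)+\pi(\gamma^{-1})^*)\big)$, where $\omega(a)=a(a^*a)^{-1/2}$, and let $u_{ij}=\breve\pi(\gamma_{ij})$. For $I=\{i_1<\dots<i_m\}$ contained in a simplex, let $u_I=u_{i_1i_2}\cdots u_{i_{m-1}i_m}$. Then $\beta(\pi)=\{w_{ij}\}$ is the $GL(A)$-coordinate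 bundle such that for $i<j$, for every simplex $\sigma\ni i,j$ and every $t\in c^\sigma_{ij}$, $$w_{ij}(t)=\sum_{I}\ \prod_{k\in\sigma,\ i\le k\le j}s'_k\;u_I ,\qquad s'_k=\begin{cases}t_k/t_i,&k\in I\\ 1-t_k/t_i,&k\notin I,\end{cases}$$ where $I$ runs over the subsets of $\{k\in\sigma: i\le k\le j\}$ that contain $i$ and $j$. It is said to be defined when the $\breve\pi(\gamma)$, $\gamma\in\mathcal F_\Lambda$, are unitary and such a coordinate bundle exists; the bundle is then unique. **Theorem.** There are positive constants $C_1,\varepsilon_1,\delta_1$, depending only on $\Lambda$ and the fixed choices of $T$, $i_0$, $s$ and the vertex order, such that the following holds for every unital $C^*$-algebra $A$. 1. If $0<\varepsilon<\varepsilon_1$ and $\mathbf v$ is a normalized $\varepsilon$-flat $GL(A)$-coordinate bundle on $\Lambda$, then $\beta(\alpha(\mathbf v))$ is defined and $d\big(\beta(\alpha(\mathbf v)),\mathbf v\big)\le C_1\varepsilon$. 2. If $0<\delta<\delta_1$ and $\pi:\Gamma\to GL(A)$ is an $(\mathcal F_\Lambda,\delta)$-representation, then $\beta(\pi)$ is defined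 and $d\big(\alpha(\beta(\pi)),\pi\big)\le C_1\delta$. -/

import Mathlib

noncomputable section

namespace AbstractSimplicialComplex

/-! ### Simplicial complexes: edges, edge paths, the edge-path group -/

section Combinatorics

variable {V : Type*} (Λ : AbstractSimplicialComplex V)

/-- `i` and `j` are (not necessarily distinct) vertices of a common simplex. -/
def Joined (i j : V) : Prop := ∃ σ ∈ Λ.faces, i ∈ σ ∧ j ∈ σ

/-- `i`, `j`, `k` are (not necessarily distinct) vertices of a common simplex. -/
def Joined₃ (i j k : V) : Prop := ∃ σ ∈ Λ.faces, i ∈ σ ∧ j ∈ σ ∧ k ∈ σ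

/-- The 1-skeleton: distinct vertices `i`, `j` are adjacent iff `⟨i, j⟩` is a 1-simplex. -/
def skeleton : SimpleGraph V where
  Adj i j := i ≠ j ∧ Λ.Joined i j
  symm := ⟨fun _ _ h => ⟨h.1.symm, let ⟨σ, hσ, hi, hj⟩ := h.2; ⟨σ, hσ, hj, hi⟩⟩⟩
  loopless := ⟨fun _ h => h.1 rfl⟩

/-- Oriented edges `⟨i, j⟩`, including the degenerate ones `⟨i, i⟩ = ⟨i⟩`. -/
def Edge : Type _ := {p : V × V // Λ.Joined p.1 p.2}

/-- Equivalence of edge paths with fixed end points: the smallest congruence for concatenation such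
that `(i, j, i) ∼ (i)` for every edge, and `(i, j, k) ∼ (i, k)` for every 2-simplex. -/
inductive EdgePathEquiv : ∀ {i j : V}, Λ.skeleton.Walk i j → Λ.skeleton.Walk i j → Prop
  | refl {i j : V} (p : Λ.skeleton.Walk i j) : EdgePathEquiv p p
  | symm {i j : V} {p p' : Λ.skeleton.Walk i j} : EdgePathEquiv p p' → EdgePathEquiv p' p
  | trans {i j : V} {p p' p'' : Λ.skeleton.Walk i j} :
      EdgePathEquiv p p' → EdgePathEquiv p' p'' → EdgePathEquiv p p''
  | append {i j k : V} {p p' : Λ.skeleton.Walk i j} {r r' : Λ.skeleton.Walk j k} :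
      EdgePathEquiv p p' → EdgePathEquiv r r' → EdgePathEquiv (p.append r) (p'.append r')
  | backtrack {i j : V} (h : Λ.skeleton.Adj i j) :
      EdgePathEquiv (.cons h (.cons h.symm .nil)) .nil
  | triangle {i j k : V} (hij : Λ.skeleton.Adj i j) (hjk : Λ.skeleton.Adj j k)
      (hik : Λ.skeleton.Adj i k) (h : Λ.Joined₃ i j k) :
      EdgePathEquiv (.cons hij (.cons hjk .nil)) (.cons hik .nil)

variable {Λ}

theorem EdgePathEquiv.reverse {i j : V} {p p' : Λ.skeleton.Walk i j}
    (h : Λ.EdgePathEquiv p p') : Λ.EdgePathEquiv p.reverse p'.reverse := by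
  induction h with
  | refl p => exact .refl _
  | symm _ ih => exact .symm ih
  | trans _ _ ih ih' => exact .trans ih ih'
  | append _ _ ih ih' =>
    rw [SimpleGraph.Walk.reverse_append, SimpleGraph.Walk.reverse_append]
    exact .append ih' ih
  | backtrack h => simpa using EdgePathEquiv.backtrack h
  | triangle hij hjk hik h =>
    obtain ⟨σ, hσ, hi, hj, hk⟩ := h
    simpa using EdgePathEquiv.triangle hjk.symm hij.symm hik.symm ⟨σ, hσ, hk, hj, hi⟩

theorem EdgePathEquiv.reverse_append_self {i j : V} (p : Λ.skeleton.Walk i j) :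
    Λ.EdgePathEquiv (p.reverse.append p) .nil := by
  induction p with
  | nil => exact .refl _
  | @cons u v w h p ih =>
    have h1 : ((SimpleGraph.Walk.cons h p).reverse).append (SimpleGraph.Walk.cons h p)
        = p.reverse.append ((SimpleGraph.Walk.cons h.symm (.cons h .nil)).append p) := by
      rw [SimpleGraph.Walk.reverse_cons, ← SimpleGraph.Walk.append_assoc]
      rfl
    rw [h1]
    refine .trans (.append (.refl _) (.append (.backtrack h.symm) (.refl p))) ?_
    simpa using ih

variable (Λ)

/-- Edge loops at `i₀` up to equivalence of edge paths. -/
def edgeLoopSetoid (i₀ : V) : Setoid (Λ.skeleton.Walk i₀ i₀) where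
  r := Λ.EdgePathEquiv
  iseqv := ⟨.refl, .symm, .trans⟩

/-- The edge-path group `E(Λ, i₀)`, the combinatorial form of the fundamental group of `|Λ|`. -/
def EdgePathGroup (i₀ : V) : Type _ := Quotient (Λ.edgeLoopSetoid i₀)

/-- The class of an edge loop in `E(Λ, i₀)`. -/
def edgeLoopClass {i₀ : V} (p : Λ.skeleton.Walk i₀ i₀) : Λ.EdgePathGroup i₀ :=
  Quotient.mk (Λ.edgeLoopSetoid i₀) p

/-- The product is concatenation of loops (first factor first). -/
instance (i₀ : V) : Group (Λ.EdgePathGroup i₀) where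
  mul := Quotient.map₂ (fun p r => p.append r) (fun _ _ h _ _ h' => .append h h')
  one := Λ.edgeLoopClass .nil
  inv := Quotient.map (fun p => p.reverse) (fun _ _ h => EdgePathEquiv.reverse h)
  mul_assoc := by
    rintro ⟨a⟩ ⟨b⟩ ⟨c⟩
    exact congrArg Λ.edgeLoopClass (SimpleGraph.Walk.append_assoc a b c).symm
  one_mul := by
    rintro ⟨a⟩
    exact congrArg Λ.edgeLoopClass (SimpleGraph.Walk.nil_append a)
  mul_one := by
    rintro ⟨a⟩
    exact congrArg Λ.edgeLoopClass (SimpleGraph.Walk.append_nil a)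
  inv_mul_cancel := by
    rintro ⟨a⟩
    exact Quotient.sound (EdgePathEquiv.reverse_append_self a)

/-- A maximal (i.e. spanning) tree of `Λ` together with a root vertex. -/
structure RootedTree where
  /-- the tree, as a graph on the vertices of `Λ` -/
  tree : SimpleGraph V
  isTree : tree.IsTree
  le_skeleton : tree ≤ Λ.skeleton
  /-- the root `i₀` -/
  root : V

variable {Λ}

/-- The edge path consisting of a single edge `⟨i, j⟩` (the constant path if `i = j`). -/
def Edge.walk (e : Λ.Edge) : Λ.skeleton.Walk e.1.1 e.1.2 :=
  open Classical in
  if h : e.1.1 = e.1.2 then (SimpleGraph.Walk.nil).copy rfl h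
  else .cons (show Λ.skeleton.Adj _ _ from ⟨h, e.2⟩) .nil

namespace RootedTree

variable (T : Λ.RootedTree)

/-- The unique path along the tree from the root to the vertex `i`. -/
def path (i : V) : Λ.skeleton.Walk T.root i :=
  (T.isTree.existsUnique_path T.root i).choose.mapLe T.le_skeleton

/-- The fundamental group `Γ = E(Λ, i₀)`. -/
abbrev Γ : Type _ := Λ.EdgePathGroup T.root

/-- `γ_{ij} ∈ Γ`: go from the root to `i` along the tree, along the edge to `j`, and back to the
root along the tree. -/
def γ (e : Λ.Edge) : T.Γ :=
  Λ.edgeLoopClass (((T.path e.1.1).append e.walk).append (T.path e.1.2).reverse)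

/-- The homomorphism `q : 𝔽_Λ → Γ` from the free group on the edges. -/
def q : FreeGroup Λ.Edge →* T.Γ := FreeGroup.lift T.γ

/-- The generating set `ℱ_Λ` of `Γ`. -/
def generators : Set T.Γ := Set.range T.γ

end RootedTree

end Combinatorics

/-! ### Geometric realization and dual cells -/

section Geometry

variable {V : Type*} [Fintype V] (Λ : AbstractSimplicialComplex V)

/-- The geometric realization `|Λ|` in barycentric coordinates, with the topology induced from the
finite-dimensional space `V → ℝ`. -/
def realization : Set (V → ℝ) :=
  {t | (∀ i, 0 ≤ t i) ∧ ∑ i, t i = 1 ∧ ∃ σ ∈ Λ.faces, ∀ k, k ∉ σ → t k = 0}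

/-- The dual cell block `c_i^σ`. -/
def dualCellBlock (σ : Finset V) (i : V) : Set (V → ℝ) :=
  {t | t ∈ Λ.realization ∧ (∀ k, k ∉ σ → t k = 0) ∧ ∀ j ∈ σ, t j ≤ t i}

/-- The dual cell `c_i`, the union of the blocks `c_i^σ` over the simplices `σ ∋ i`. -/
def dualCell (i : V) : Set (V → ℝ) :=
  {t | ∃ σ ∈ Λ.faces, i ∈ σ ∧ t ∈ Λ.dualCellBlock σ i}

theorem mem_dualCell {i : V} {t : V → ℝ} :
    t ∈ Λ.dualCell i ↔ t ∈ Λ.realization ∧ ∀ j, t j ≤ t i := by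
  constructor
  · rintro ⟨σ, _, _, ht, h0, hle⟩
    refine ⟨ht, fun j => ?_⟩
    by_cases hj : j ∈ σ
    · exact hle j hj
    · rw [h0 j hj]; exact ht.1 i
  · rintro ⟨ht, hle⟩
    obtain ⟨h0, h1, σ, hσ, hs⟩ := ht
    refine ⟨σ, hσ, ?_, ⟨h0, h1, σ, hσ, hs⟩, hs, fun j _ => hle j⟩
    by_contra hi
    have : ∑ j, t j ≤ 0 := Finset.sum_nonpos fun j _ => (hle j).trans (hs i hi).le
    linarith

/-- The intersection `c_{ij} = c_i ∩ c_j`. -/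
abbrev dualCell₂ (i j : V) : Set (V → ℝ) := Λ.dualCell i ∩ Λ.dualCell j

theorem isCompact_dualCell (i : V) : IsCompact (Λ.dualCell i) := by
  have hcl : IsClosed (Λ.dualCell i) := by
    have : Λ.dualCell i = {t | ∀ j, 0 ≤ t j} ∩ {t | ∑ j, t j = 1} ∩
        (⋃ σ ∈ Λ.faces, {t | ∀ k, k ∉ σ → t k = 0}) ∩ {t | ∀ j, t j ≤ t i} := by
      ext t
      rw [mem_dualCell]
      simp [realization, and_assoc]
    rw [this]
    refine ((IsClosed.inter ?_ ?_).inter ?_).inter ?_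
    · simp only [Set.ofPred_forall]
      exact isClosed_iInter fun j => isClosed_le continuous_const (continuous_apply j)
    · exact isClosed_eq (by fun_prop) continuous_const
    · refine (Set.toFinite _).isClosed_biUnion fun σ _ => ?_
      simp only [Set.ofPred_forall]
      exact isClosed_iInter fun j => isClosed_iInter fun _ =>
        isClosed_eq (continuous_apply j) continuous_const
    · simp only [Set.ofPred_forall]
      exact isClosed_iInter fun j => isClosed_le (continuous_apply j) (continuous_apply i)
  refine (isCompact_univ_pi (fun _ : V => isCompact_Icc (a := (0 : ℝ)) (b := 1))).of_isClosed_subset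
    hcl fun t ht => ?_
  obtain ⟨⟨h0, h1, -⟩, -⟩ := Λ.mem_dualCell.1 ht
  intro j _
  exact ⟨h0 j, h1 ▸ Finset.single_le_sum (fun k _ => h0 k) (Finset.mem_univ j)⟩

open Classical in
/-- The barycenter of a 1-simplex `⟨i, j⟩`. -/
def edgeBarycenter (i j : V) : V → ℝ := fun k => if k = i ∨ k = j then 1 / 2 else 0

variable {Λ}

theorem edgeBarycenter_mem {i j : V} (h : Λ.skeleton.Adj i j) :
    edgeBarycenter i j ∈ Λ.dualCell₂ i j := by
  classical
  have hr : edgeBarycenter i j ∈ Λ.realization := by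
    obtain ⟨hne, σ, hσ, hi, hj⟩ := h
    refine ⟨fun k => ?_, ?_, σ, hσ, fun k hk => ?_⟩
    · unfold edgeBarycenter; split_ifs <;> norm_num
    · have : ∀ k, edgeBarycenter i j k
          = (if k = i then (1 / 2 : ℝ) else 0) + (if k = j then (1 / 2 : ℝ) else 0) := by
        intro k
        by_cases h1 : k = i
        · subst h1; simp [edgeBarycenter, hne]
        · by_cases h2 : k = j
          · subst h2; simp [edgeBarycenter, hne.symm]
          · simp [edgeBarycenter, h1, h2]
      simp only [this, Finset.sum_add_distrib, Finset.sum_ite_eq', Finset.mem_univ, if_true]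
      norm_num
    · have h1 : k ≠ i := fun e => hk (e ▸ hi)
      have h2 : k ≠ j := fun e => hk (e ▸ hj)
      simp [edgeBarycenter, h1, h2]
  constructor <;> refine Λ.mem_dualCell.2 ⟨hr, fun k => ?_⟩ <;>
    · simp only [edgeBarycenter]
      split_ifs <;> simp_all

end Geometry

/-! ### Coordinate bundles and the map `α` -/

section Bundles

variable {V : Type*} [Fintype V] (Λ : AbstractSimplicialComplex V)
variable (A : Type*) [CStarAlgebra A]

/-- A `GL(A)`-coordinate bundle on `Λ`: continuous functions `v_{ij} : c_{ij} → GL(A)`, one for each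
oriented 1-simplex, satisfying the cocycle identities. -/
structure CoordBundle where
  /-- the functions `v_{ij}` -/
  fn : ∀ i j : V, Λ.skeleton.Adj i j → C(Λ.dualCell₂ i j, Aˣ)
  inv_eq : ∀ (i j : V) (h : Λ.skeleton.Adj i j) (t : V → ℝ) (hi : t ∈ Λ.dualCell i)
    (hj : t ∈ Λ.dualCell j), fn i j h ⟨t, hi, hj⟩ = (fn j i h.symm ⟨t, hj, hi⟩)⁻¹
  cocycle : ∀ (i j k : V) (hij : Λ.skeleton.Adj i j) (hjk : Λ.skeleton.Adj j k)
    (hik : Λ.skeleton.Adj i k), Λ.Joined₃ i j k →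
    ∀ (t : V → ℝ) (hi : t ∈ Λ.dualCell i) (hj : t ∈ Λ.dualCell j) (hk : t ∈ Λ.dualCell k),
    fn i k hik ⟨t, hi, hk⟩ = fn i j hij ⟨t, hi, hj⟩ * fn j k hjk ⟨t, hj, hk⟩

/-- `U(A)_δ`, the set of elements at distance less than `δ` from the unitary group. -/
def nearUnitary (δ : ℝ) : Set A := Metric.thickening δ (unitary A : Set A)

namespace CoordBundle

variable {Λ A}

/-- `ε`-flatness of a coordinate bundle. -/
structure IsFlat (ε : ℝ) (v : Λ.CoordBundle A) : Prop where
  near : ∀ (i j : V) (h : Λ.skeleton.Adj i j) (x : Λ.dualCell₂ i j),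
    (v.fn i j h x : A) ∈ nearUnitary A ε
  flat : ∀ (i j : V) (h : Λ.skeleton.Adj i j) (x y : Λ.dualCell₂ i j),
    ‖(v.fn i j h x : A) - (v.fn i j h y : A)‖ < ε

/-- `d(v, w) = max_{⟨i,j⟩} max_{x ∈ c_{ij}} ‖v_{ij}(x) - w_{ij}(x)‖`. -/
protected def dist (v w : Λ.CoordBundle A) : ℝ :=
  ⨆ e : Λ.skeleton.Dart, ⨆ x : Λ.dualCell₂ e.fst e.snd,
    ‖(v.fn e.fst e.snd e.adj x : A) - (w.fn e.fst e.snd e.adj x : A)‖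

/-- The suprema in `CoordBundle.dist` are over bounded families. -/
theorem norm_sub_le_dist (v w : Λ.CoordBundle A) (i j : V) (h : Λ.skeleton.Adj i j)
    (x : Λ.dualCell₂ i j) :
    ‖(v.fn i j h x : A) - (w.fn i j h x : A)‖ ≤ v.dist w := by
  have hfin : Finite Λ.skeleton.Dart :=
    Finite.of_injective (fun d => d.toProd) SimpleGraph.Dart.toProd_injective
  have hc : CompactSpace (Λ.dualCell₂ i j) :=
    isCompact_iff_compactSpace.1
      ((Λ.isCompact_dualCell i).inter_right (Λ.isCompact_dualCell j).isClosed)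
  have hb : BddAbove (Set.range fun x : Λ.dualCell₂ i j =>
      ‖(v.fn i j h x : A) - (w.fn i j h x : A)‖) := by
    have hcont : Continuous fun x : Λ.dualCell₂ i j =>
        ‖(v.fn i j h x : A) - (w.fn i j h x : A)‖ :=
      ((Units.continuous_val.comp (v.fn i j h).continuous).sub
        (Units.continuous_val.comp (w.fn i j h).continuous)).norm
    exact (isCompact_range hcont).bddAbove
  refine (le_ciSup hb x).trans ?_
  exact le_ciSup (f := fun e : Λ.skeleton.Dart => ⨆ x : Λ.dualCell₂ e.fst e.snd,
    ‖(v.fn e.fst e.snd e.adj x : A) - (w.fn e.fst e.snd e.adj x : A)‖)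
    (Set.finite_range _).bddAbove ⟨(i, j), h⟩

/-- The value of `v_{ij}` at the barycenter of the 1-simplex `⟨i, j⟩`. -/
def atBary (v : Λ.CoordBundle A) {i j : V} (h : Λ.skeleton.Adj i j) : Aˣ :=
  v.fn i j h ⟨edgeBarycenter i j, edgeBarycenter_mem h⟩

/-- The product of the barycentric values along an edge path `(i₁, …, i_m)`. -/
def alongWalk (v : Λ.CoordBundle A) {i j : V} (p : Λ.skeleton.Walk i j) : Aˣ :=
  (p.darts.map fun d => v.atBary d.adj).prod

/-- `v` is normalized if `v_{ij}` is `1` at the barycenter of each edge `⟨i, j⟩` of the tree. -/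
def IsNormalized (T : Λ.RootedTree) (v : Λ.CoordBundle A) : Prop :=
  ∀ (i j : V) (h : T.tree.Adj i j), v.atBary (T.le_skeleton h) = 1

/-- The homomorphism `π̃ : 𝔽_Λ → GL(A)`, which sends `⟨i, j⟩` to
`v̂_I v̂_{ij} v̂_J⁻¹`, where `I`, `J` are the tree paths from the root to `i`, `j`
(and the factor in the middle is `1` on a degenerate edge). -/
def lift (T : Λ.RootedTree) (v : Λ.CoordBundle A) : FreeGroup Λ.Edge →* Aˣ :=
  FreeGroup.lift fun e =>
    v.alongWalk (T.path e.1.1) * v.alongWalk e.walk * (v.alongWalk (T.path e.1.2))⁻¹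

/-- The map `α`, which depends on the section `s : Γ → 𝔽_Λ`. -/
def alpha (T : Λ.RootedTree) (s : T.Γ → FreeGroup Λ.Edge) (v : Λ.CoordBundle A) : T.Γ → Aˣ :=
  fun γ => v.lift T (s γ)

end CoordBundle

end Bundles

/-! ### Quasi-representations and the map `β` -/

section QuasiRep

/-- `π` is an `(F, δ)`-representation of the group `G` to `GL(A)`. -/
structure IsQuasiRep {G A : Type*} [Group G] [CStarAlgebra A] (F : Set G) (δ : ℝ) (π : G → Aˣ) :
    Prop where
  near : ∀ γ ∈ F, (π γ : A) ∈ nearUnitary A δ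
  mul : ∀ γ ∈ F, ∀ γ' ∈ F, ‖(π (γ * γ') : A) - (π γ : A) * (π γ' : A)‖ < δ
  one : π 1 = 1

/-- `ω(a) = a (a* a)^{-1/2}`, the unitary part of the polar decomposition of an invertible `a`. -/
def unitaryPart {A : Type*} [CStarAlgebra A] (a : A) : A :=
  a * cfc (fun x : ℝ => x ^ (-(1 / 2) : ℝ)) (star a * a)

/-- The unitary perturbation `π̆(γ) = ω((π(γ) + π(γ⁻¹)*) / 2)`. -/
def perturb {G A : Type*} [Group G] [CStarAlgebra A] (π : G → Aˣ) (γ : G) : A :=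
  unitaryPart ((1 / 2 : ℝ) • ((π γ : A) + star (π γ⁻¹ : A)))

/-- The elements of a finite chain `I` listed in increasing order. -/
theorem exists_ascending {V : Type*} [PartialOrder V] (I : Finset V)
    (h : IsChain (· ≤ ·) (I : Set V)) : ∃ l : List V, l.Pairwise (· < ·) ∧ ∀ k, k ∈ l ↔ k ∈ I := by
  let J : Finset (LinearExtension V) := I
  have hJ : J.sort.Pairwise (· < ·) := List.sortedLT_iff_pairwise.1 (Finset.sortedLT_sort J)
  have key : ∀ a b : V, a ∈ I → b ∈ I → toLinearExtension a < toLinearExtension b → a < b := by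
    intro a b ha hb hab
    have hne : a ≠ b := by rintro rfl; exact lt_irrefl _ hab
    rcases h ha hb hne with h1 | h1
    · exact lt_of_le_of_ne h1 hne
    · exact absurd (toLinearExtension.monotone h1) (not_le_of_gt hab)
  have hm : ∀ k, k ∈ J.sort ↔ k ∈ J := fun k => Finset.mem_sort (· ≤ ·)
  have hV : J.sort.Pairwise (fun a b => @LT.lt V _ a b) :=
    hJ.imp_of_mem fun {a b} ha hb hab => key a b ((hm a).1 ha) ((hm b).1 hb) hab
  have hex : ∃ l : List (LinearExtension V),
      l.Pairwise (fun a b => @LT.lt V _ a b) ∧ ∀ k, k ∈ l ↔ k ∈ J := ⟨J.sort, hV, hm⟩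
  exact hex

open Classical in
/-- The elements of `I`, listed in increasing order, if `I` is a chain. -/
def ascending {V : Type*} [PartialOrder V] (I : Finset V) : List V :=
  if h : IsChain (· ≤ ·) (I : Set V) then (exists_ascending I h).choose else []

variable {V : Type*} {Λ : AbstractSimplicialComplex V} {A : Type*} [CStarAlgebra A]

namespace RootedTree

variable (T : Λ.RootedTree)

/-- `d(π, π') = max_{γ ∈ ℱ_Λ} ‖π(γ) - π'(γ)‖`. -/
def repDist (π π' : T.Γ → Aˣ) : ℝ :=
  ⨆ γ : T.generators, ‖(π γ : A) - (π' γ : A)‖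

open Classical in
/-- `u_{ij} = π̆(γ_{ij})` for `i`, `j` in a common simplex (and, by convention, `1` otherwise). -/
def u (π : T.Γ → Aˣ) (i j : V) : A :=
  if h : Λ.Joined i j then perturb π (T.γ ⟨(i, j), h⟩) else 1

/-- `u_I = u_{i₁i₂} u_{i₂i₃} ⋯ u_{i_{m-1}i_m}` for `I = {i₁ < i₂ < ⋯ < i_m}`. -/
def uPath [PartialOrder V] (π : T.Γ → Aˣ) (I : Finset V) : A :=
  (List.zipWith (T.u π) (ascending I) (ascending I).tail).prod

open Classical in
/-- The function `v_{ij}^σ` for `i < j` in `σ`, at the point with barycentric coordinates `t`, that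
is with modified barycentric coordinates `s_k = t_k / t_i`:
`∑_I λ_I(s) u_I` over the `I ⊆ {k ∈ σ | i ≤ k ≤ j}` that contain `i` and `j`, where `λ_I(s)` is the
product over `k ∈ σ`, `i ≤ k ≤ j`, of `s_k` if `k ∈ I` and of `1 - s_k` if `k ∉ I`. -/
def blockFun [PartialOrder V] (π : T.Γ → Aˣ) (σ : Finset V) (i j : V) (t : V → ℝ) : A :=
  ∑ I ∈ (σ.filter fun k => i ≤ k ∧ k ≤ j).powerset.filter (fun I => i ∈ I ∧ j ∈ I),
    (∏ k ∈ σ.filter fun k => i ≤ k ∧ k ≤ j, if k ∈ I then t k / t i else 1 - t k / t i) •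
      T.uPath π I

/-- `β(π)` is defined and equal to the coordinate bundle `w`: the elements `π̆(γ)`, `γ ∈ ℱ_Λ`, are
unitary and, for `i < j`, the function `w_{ij}` restricts to `v_{ij}^σ` on `c_{ij}^σ` for all
simplices `σ` that contain `i` and `j`. The functions `w_{ij}` with `i > j` are then determined, as
pointwise inverses, by the definition of a coordinate bundle. -/
structure IsBeta [Fintype V] [PartialOrder V] (π : T.Γ → Aˣ) (w : Λ.CoordBundle A) : Prop where
  unitary : ∀ γ ∈ T.generators, perturb π γ ∈ _root_.unitary A
  eq : ∀ (i j : V) (h : Λ.skeleton.Adj i j), i < j → ∀ σ ∈ Λ.faces, i ∈ σ → j ∈ σ →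
    ∀ x : Λ.dualCell₂ i j, x.1 ∈ Λ.dualCellBlock σ i ∩ Λ.dualCellBlock σ j →
    (w.fn i j h x : A) = T.blockFun π σ i j x.1

/-- There is at most one coordinate bundle `β(π)`. -/
theorem IsBeta.unique [Fintype V] [PartialOrder V]
    (hord : ∀ σ ∈ Λ.faces, IsChain (· ≤ ·) (σ : Set V)) {π : T.Γ → Aˣ} {w w' : Λ.CoordBundle A}
    (h : T.IsBeta π w) (h' : T.IsBeta π w') : w = w' := by
  have key : ∀ (i j : V) (hij : Λ.skeleton.Adj i j), i < j → ∀ x : Λ.dualCell₂ i j,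
      w.fn i j hij x = w'.fn i j hij x := by
    intro i j hij hlt x
    obtain ⟨σ, hσ, hi, hb⟩ := x.2.1
    have hx := x.2
    rw [Set.mem_inter_iff, mem_dualCell, mem_dualCell] at hx
    have hij' : x.1 i = x.1 j := le_antisymm (hx.2.2 i) (hx.1.2 j)
    have hj : j ∈ σ := by
      by_contra hj
      have h0 := hb.2.1 j hj
      have : ∑ k, x.1 k ≤ 0 := Finset.sum_nonpos fun k _ => (hx.2.2 k).trans h0.le
      linarith [hx.1.1.2.1]
    have hb' : x.1 ∈ Λ.dualCellBlock σ j := ⟨hb.1, hb.2.1, fun k hk => hij' ▸ hb.2.2 k hk⟩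
    apply Units.ext
    rw [h.eq i j hij hlt σ hσ hi hj x ⟨hb, hb'⟩, h'.eq i j hij hlt σ hσ hi hj x ⟨hb, hb'⟩]
  have hv : w.fn = w'.fn := by
    funext i j hij
    ext1 x
    have hc := hij.2
    obtain ⟨σ, hσ, hi, hj⟩ := hc
    rcases hord σ hσ hi hj hij.1 with hle | hle
    · exact key i j hij (lt_of_le_of_ne hle hij.1) x
    · rw [w.inv_eq i j hij x.1 x.2.1 x.2.2, w'.inv_eq i j hij x.1 x.2.1 x.2.2,
        key j i hij.symm (lt_of_le_of_ne hle hij.1.symm)]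
  cases w; cases w'; cases hv; rfl

end RootedTree

end QuasiRep

end AbstractSimplicialComplex

end

/-!
The idea is that both compositions only move things by quantities that are controlled by finitely
many relations of the finite complex `Λ`.

*Holonomy.* In an `ε`-flat bundle the values of the transition functions at the barycenters of the
edges satisfy the cocycle identity of each triangle up to `5 * ε`, since it holds exactly at the
barycenter of the triangle. Hence each elementary move between edge paths changes the holonomy by
`O(ε)`, and two words in the edges with the same image in `Γ` have holonomies at distance `O(ε)`,
with a constant that depends on the words only (`RootedTree.exists_norm_lift_sub_le`). There are
finitely many generators `γ_{ij}`, so one constant serves all the pairs of words `s(γ_{ij})`,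
`⟨i, j⟩` and `s(γγ')`, `s(γ)s(γ')`. If the transition functions nearly equal `1` on the tree, this
says that `α(v)` is an `(ℱ_Λ, O(ε))`-representation whose value at `γ_{ij}` is close to `v̂_{ij}`.

*Interpolation.* If `π` is an `(ℱ_Λ, δ)`-representation, the polar decomposition shows that
`u_{ij} = π̆(γ_{ij})` is a unitary close to `π(γ_{ij})`, so `u_{ij} u_{jk} ≈ u_{ik}` on every simplex.
The function `w_{ij}(t)` is a convex combination of the products `u_I`, all of which are close to
`u_{ij}`; so it is invertible for small `δ` (`RootedTree.norm_blockFun_sub_le`). Where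
`t_i = t_j = t_k`, the sets `I` that miss `j` have weight `0`, and the others split at `j`, which
gives the exact cocycle identity (`RootedTree.blockFun_mul_blockFun`). So `β(π)` exists and its
transition functions are within `O(δ)` of the elements `π(γ_{ij})` (`RootedTree.exists_isBeta`).

Both estimates of the theorem follow: for the first, the second construction is applied to `α(v)`;
for the second, `β(π)` is itself `O(δ)`-flat and nearly `1` on the tree, because `γ_{ij} = 1` there,
so that the holonomy estimate applies to it.
-/

noncomputable section

namespace AbstractSimplicialComplex

universe u

/-! ### Elements of a `C*`-algebra close to unitaries -/

section CStar

variable {A : Type*} [CStarAlgebra A]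

/-- Unlike `CStarRing.norm_of_mem_unitary`, this includes the trivial algebra. -/
theorem norm_le_one_of_mem_unitary {U : A} (hU : U ∈ unitary A) : ‖U‖ ≤ 1 := by
  cases subsingleton_or_nontrivial A
  · simp [Subsingleton.elim U 0]
  · exact (CStarRing.norm_of_mem_unitary hU).le

theorem norm_one_le_one : ‖(1 : A)‖ ≤ 1 := norm_le_one_of_mem_unitary (one_mem _)

theorem exists_unitary_of_mem_nearUnitary {δ : ℝ} {a : A} (h : a ∈ nearUnitary A δ) :
    ∃ U ∈ unitary A, ‖a - U‖ < δ := by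
  obtain ⟨U, hU, hd⟩ := Metric.mem_thickening_iff.1 h
  exact ⟨U, hU, by rwa [← dist_eq_norm]⟩

theorem norm_le_of_mem_nearUnitary {δ : ℝ} {a : A} (h : a ∈ nearUnitary A δ) : ‖a‖ ≤ 1 + δ := by
  obtain ⟨U, hU, hd⟩ := exists_unitary_of_mem_nearUnitary h
  have := norm_le_one_of_mem_unitary hU
  have := norm_le_insert' a U
  linarith

theorem mem_nearUnitary_of_norm_sub_lt {δ : ℝ} {a U : A} (hU : U ∈ unitary A)
    (h : ‖a - U‖ < δ) : a ∈ nearUnitary A δ :=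
  Metric.mem_thickening_iff.2 ⟨U, hU, by rwa [dist_eq_norm]⟩

theorem norm_mul_sub_mul_le (a b c d : A) : ‖a * b - c * d‖ ≤ ‖a - c‖ * ‖b‖ + ‖c‖ * ‖b - d‖ := by
  have : a * b - c * d = (a - c) * b + c * (b - d) := by noncomm_ring
  rw [this]
  exact (norm_add_le _ _).trans (add_le_add (norm_mul_le _ _) (norm_mul_le _ _))

theorem isUnit_of_norm_sub_unitary_lt {a U : A} (hU : U ∈ unitary A) (h : ‖a - U‖ < 1) :
    IsUnit a := by
  have h1 : ‖1 - star U * a‖ < 1 := by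
    have : 1 - star U * a = star U * (U - a) := by
      rw [mul_sub, Unitary.star_mul_self_of_mem hU]
    rw [this, CStarRing.norm_mem_unitary_mul _ (Unitary.star_mem hU), norm_sub_rev]
    exact h
  have h2 : IsUnit (star U * a) := by
    have := (Units.oneSub _ h1).isUnit
    simpa using this
  have h3 : IsUnit U := ⟨Unitary.toUnits ⟨U, hU⟩, rfl⟩
  have : a = U * (star U * a) := by rw [← mul_assoc, Unitary.mul_star_self_of_mem hU, one_mul]
  rw [this]
  exact h3.mul h2

/-- An element at distance at most `1/2` from a unitary `U` has its inverse close to `U*`. -/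
theorem norm_inv_sub_star_le {U : A} (hU : U ∈ unitary A) (a : Aˣ) (h : ‖(a : A) - U‖ ≤ 1 / 2) :
    ‖((a⁻¹ : Aˣ) : A) - star U‖ ≤ 2 * ‖(a : A) - U‖ := by
  have key : ((a⁻¹ : Aˣ) : A) - star U = ((a⁻¹ : Aˣ) : A) * (U - a) * star U := by
    rw [mul_sub, sub_mul, mul_assoc, Unitary.mul_star_self_of_mem hU, mul_one, Units.inv_mul,
      one_mul]
  have h1 : ‖((a⁻¹ : Aˣ) : A) - star U‖ ≤ ‖((a⁻¹ : Aˣ) : A)‖ * ‖(a : A) - U‖ := by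
    rw [key, CStarRing.norm_mul_mem_unitary _ (Unitary.star_mem hU), ← norm_sub_rev U]
    exact norm_mul_le _ _
  have h2 : ‖((a⁻¹ : Aˣ) : A)‖ ≤ 2 := by
    have h3 := norm_le_insert' ((a⁻¹ : Aˣ) : A) (star U)
    have h4 := norm_le_one_of_mem_unitary (Unitary.star_mem hU)
    nlinarith [norm_nonneg ((a⁻¹ : Aˣ) : A), norm_nonneg ((a : A) - U)]
  exact h1.trans (mul_le_mul_of_nonneg_right h2 (norm_nonneg _))

theorem norm_star_mul_self_sub_one_le {a U : A} (hU : U ∈ unitary A) {η : ℝ} (hη : η ≤ 1 / 8)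
    (h : ‖a - U‖ ≤ η) : ‖star a * a - 1‖ ≤ 3 * η := by
  rw [← Unitary.star_mul_self_of_mem hU]
  refine (norm_mul_sub_mul_le _ _ _ _).trans ?_
  have h1 := norm_le_one_of_mem_unitary hU
  have h2 := norm_le_insert' a U
  rw [← star_sub, norm_star, norm_star]
  nlinarith [norm_nonneg (a - U), norm_nonneg U, norm_nonneg a]

theorem spectrum_star_mul_self_subset {a U : A} (hU : U ∈ unitary A) {η : ℝ} (hη : η ≤ 1 / 8)
    (h : ‖a - U‖ ≤ η) {x : ℝ} (hx : x ∈ spectrum ℝ (star a * a)) : |x - 1| ≤ 3 * η := by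
  have h1 : x - 1 ∈ spectrum ℝ (star a * a - 1) := by
    simpa [sub_eq_add_neg, add_comm] using spectrum.add_mem_add_iff (R := ℝ) (a := star a * a) (r := x) (s := -1) |>.2 hx
  have h2 := spectrum.norm_le_norm_mul_of_mem h1
  rw [Real.norm_eq_abs] at h2
  have h3 := norm_star_mul_self_sub_one_le hU hη h
  nlinarith [norm_nonneg (star a * a - 1), norm_one_le_one (A := A)]

/-- With `y = √x`, this is `|y² - 1| = |y⁻¹ - 1| y (1 + y)` together with `y (1 + y) ≥ 1`. -/
theorem abs_rpow_neg_half_sub_one_le {x : ℝ} (hx : 1 / 2 ≤ x) :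
    |x ^ (-(1 / 2) : ℝ) - 1| ≤ |x - 1| := by
  have h0 : 0 < x := by linarith
  set y := √x with hy
  have hy2 : y ^ 2 = x := Real.sq_sqrt h0.le
  have hy1 : 1 / 2 ≤ y := by
    rw [hy]; apply Real.le_sqrt_of_sq_le; linarith
  have hr : x ^ (-(1 / 2) : ℝ) = y⁻¹ := by
    rw [Real.rpow_neg h0.le, hy, Real.sqrt_eq_rpow]
  have hy0 : 0 < y := by linarith
  have h1 : x - 1 = (y⁻¹ - 1) * (-(y * (1 + y))) := by
    field_simp; nlinarith
  rw [hr, h1, abs_mul, abs_neg, abs_of_pos (by positivity : 0 < y * (1 + y))]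
  have : 1 ≤ y * (1 + y) := by nlinarith
  nlinarith [abs_nonneg (y⁻¹ - 1)]

theorem continuousOn_rpow_spectrum {a U : A} (hU : U ∈ unitary A) {η : ℝ}
    (hη : η ≤ 1 / 8) (h : ‖a - U‖ ≤ η) :
    ContinuousOn (fun x : ℝ => x ^ (-(1 / 2) : ℝ)) (spectrum ℝ (star a * a)) := by
  intro x hx
  have := abs_le.1 (spectrum_star_mul_self_subset hU hη h hx)
  exact (Real.continuousAt_rpow_const x _ (Or.inl (by linarith : 0 < x).ne')).continuousWithinAt

theorem norm_unitaryPart_sub_le {a U : A} (hU : U ∈ unitary A) {η : ℝ}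
    (hη : η ≤ 1 / 8) (h : ‖a - U‖ ≤ η) :
    ‖unitaryPart a - U‖ ≤ 7 * η := by
  have hη0 : 0 ≤ η := (norm_nonneg _).trans h
  have hsa : IsSelfAdjoint (star a * a) := IsSelfAdjoint.star_mul_self a
  have hc := continuousOn_rpow_spectrum hU hη h
  have h1 : ‖cfc (fun x : ℝ => x ^ (-(1 / 2) : ℝ)) (star a * a) - 1‖ ≤ 3 * η := by
    rw [← cfc_const_one ℝ (star a * a), ← cfc_sub _ _ _ hc (by fun_prop)]
    refine norm_cfc_le (by positivity) fun x hx => ?_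
    have h2 := spectrum_star_mul_self_subset hU hη h hx
    rw [Real.norm_eq_abs]
    refine (abs_rpow_neg_half_sub_one_le ?_).trans h2
    have := abs_le.1 h2
    linarith
  have h2 : ‖unitaryPart a - a‖ ≤ 2 * (3 * η) := by
    have : unitaryPart a - a
        = a * (cfc (fun x : ℝ => x ^ (-(1 / 2) : ℝ)) (star a * a) - 1) := by
      rw [mul_sub, mul_one]; rfl
    rw [this]
    refine (norm_mul_le _ _).trans (mul_le_mul ?_ h1 (norm_nonneg _) (by norm_num))
    have := norm_le_one_of_mem_unitary hU
    have := norm_le_insert' a U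
    linarith
  have := norm_sub_le_norm_sub_add_norm_sub (unitaryPart a) a U
  linarith

/-- With `b = (a* a)^{-1/2}` one has `b (a* a) b = 1`, so `a b` is an isometry; it is invertible because it
is close to `U`. -/
theorem unitaryPart_mem_unitary {a U : A} (hU : U ∈ unitary A) {η : ℝ}
    (hη : η ≤ 1 / 8) (h : ‖a - U‖ ≤ η) :
    unitaryPart a ∈ unitary A := by
  have hsa : IsSelfAdjoint (star a * a) := IsSelfAdjoint.star_mul_self a
  have hc := continuousOn_rpow_spectrum hU hη h
  set b := cfc (fun x : ℝ => x ^ (-(1 / 2) : ℝ)) (star a * a) with hb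
  have hbs : star b = b := (cfc_predicate (R := ℝ) _ (star a * a) : IsSelfAdjoint b)
  have h1 : b * (star a * a) * b = 1 := by
    conv_lhs => rw [← cfc_id' ℝ (star a * a)]
    rw [hb, ← cfc_mul _ _ _ hc (by fun_prop), 
      ← cfc_mul (fun x : ℝ => x ^ (-(1 / 2) : ℝ) * x) _ _ (hc.mul (by fun_prop)) hc,
      ← cfc_const_one ℝ (star a * a)]
    refine cfc_congr fun x hx => ?_
    have h2 := abs_le.1 (spectrum_star_mul_self_subset hU hη h hx)
    have h0 : 0 < x := by linarith
    have h3 : x ^ (-(1 / 2) : ℝ) * x ^ (-(1 / 2) : ℝ) = x⁻¹ := by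
      rw [← Real.rpow_add h0, ← Real.rpow_neg_one]; norm_num
    calc x ^ (-(1 / 2) : ℝ) * x * x ^ (-(1 / 2) : ℝ)
        = (x ^ (-(1 / 2) : ℝ) * x ^ (-(1 / 2) : ℝ)) * x := by ring
      _ = 1 := by rw [h3, inv_mul_cancel₀ h0.ne']
  have h2 : star (a * b) * (a * b) = 1 := by
    rw [star_mul, hbs, ← h1]; noncomm_ring
  have hau : IsUnit a := isUnit_of_norm_sub_unitary_lt hU (by linarith)
  have hω : IsUnit (unitaryPart a) := by
    refine isUnit_of_norm_sub_unitary_lt hU ?_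
    have := norm_unitaryPart_sub_le hU hη h
    linarith
  refine Unitary.mem_iff.2 ⟨h2, ?_⟩
  obtain ⟨x, hx⟩ := hω
  have h3 : star (unitaryPart a) * x = 1 := by rw [hx]; exact h2
  rw [← hx] at h3 ⊢
  rw [Units.eq_inv_of_mul_eq_one_right h3, Units.mul_inv]

section perturb

variable {G : Type*} [Group G] {F : Set G} {δ : ℝ} {π : G → Aˣ}

/-- For a quasi-representation `π`, the average in the definition of `perturb π γ` is close to a
unitary close to `π γ`. -/
theorem IsQuasiRep.exists_unitary (h : IsQuasiRep F δ π) (hδ : δ ≤ 1) {γ : G} (hγ : γ ∈ F)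
    (hγ' : γ⁻¹ ∈ F) : ∃ U ∈ unitary A, ‖(π γ : A) - U‖ ≤ δ ∧
      ‖(1 / 2 : ℝ) • ((π γ : A) + star (π γ⁻¹ : A)) - U‖ ≤ 2 * δ := by
  obtain ⟨U, hU, hd⟩ := exists_unitary_of_mem_nearUnitary (h.near γ hγ)
  refine ⟨U, hU, hd.le, ?_⟩
  have h1 : ‖(1 : A) - π γ * π γ⁻¹‖ < δ := by simpa [h.one] using h.mul γ hγ γ⁻¹ hγ'
  have h2 : ‖(π γ⁻¹ : A)‖ ≤ 2 := (norm_le_of_mem_nearUnitary (h.near _ hγ')).trans (by linarith)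
  have h3 : ‖star U - (π γ⁻¹ : A)‖ ≤ 3 * δ := by
    have : star U - (π γ⁻¹ : A)
        = star U * ((1 - π γ * π γ⁻¹) + (π γ - U) * π γ⁻¹) := by
      have := Unitary.star_mul_self_of_mem hU
      calc star U - (π γ⁻¹ : A) = star U - (star U * U) * (π γ⁻¹ : A) := by rw [this, one_mul]
        _ = _ := by noncomm_ring
    rw [this, CStarRing.norm_mem_unitary_mul _ (Unitary.star_mem hU)]
    refine (norm_add_le _ _).trans ?_
    have := norm_mul_le ((π γ : A) - U) (π γ⁻¹ : A)
    nlinarith [norm_nonneg ((π γ : A) - U)]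
  have h4 : ‖star (π γ⁻¹ : A) - U‖ ≤ 3 * δ := by
    rw [← norm_star, star_sub, star_star, norm_sub_rev]; exact h3
  have h5 : (1 / 2 : ℝ) • ((π γ : A) + star (π γ⁻¹ : A)) - U
      = (1 / 2 : ℝ) • ((π γ - U) + (star (π γ⁻¹ : A) - U)) := by
    module
  rw [h5, norm_smul, Real.norm_of_nonneg (by norm_num)]
  have := norm_add_le ((π γ : A) - U) (star (π γ⁻¹ : A) - U)
  linarith

theorem IsQuasiRep.perturb_mem_unitary (h : IsQuasiRep F δ π) (hδ : δ ≤ 1 / 16) {γ : G}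
    (hγ : γ ∈ F) (hγ' : γ⁻¹ ∈ F) : perturb π γ ∈ unitary A := by
  obtain ⟨U, hU, -, h2⟩ := h.exists_unitary (by linarith) hγ hγ'
  exact unitaryPart_mem_unitary hU (by linarith) h2

theorem IsQuasiRep.norm_perturb_sub_le (h : IsQuasiRep F δ π) (hδ : δ ≤ 1 / 16) {γ : G}
    (hγ : γ ∈ F) (hγ' : γ⁻¹ ∈ F) : ‖perturb π γ - (π γ : A)‖ ≤ 15 * δ := by
  obtain ⟨U, hU, h1, h2⟩ := h.exists_unitary (by linarith) hγ hγ'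
  have h3 : ‖perturb π γ - U‖ ≤ 7 * (2 * δ) := norm_unitaryPart_sub_le hU (by linarith) h2
  have := norm_sub_le_norm_sub_add_norm_sub (perturb π γ) U (π γ)
  rw [norm_sub_rev U] at this
  linarith

end perturb

end CStar

/-! ### The edge-path group -/

section EdgePaths

variable {V : Type*} {Λ : AbstractSimplicialComplex V}

theorem face_of_subset {σ τ : Finset V} (hσ : σ ∈ Λ.faces) (h : τ ⊆ σ) (hne : τ.Nonempty) :
    τ ∈ Λ.faces :=
  (Λ.isRelLowerSet_faces hσ).2 h hne

theorem Joined.symm {i j : V} (h : Λ.Joined i j) : Λ.Joined j i :=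
  let ⟨σ, hσ, hi, hj⟩ := h; ⟨σ, hσ, hj, hi⟩

theorem Joined₃.left {i j k : V} (h : Λ.Joined₃ i j k) : Λ.Joined i j :=
  let ⟨σ, hσ, hi, hj, _⟩ := h; ⟨σ, hσ, hi, hj⟩

theorem Joined₃.right {i j k : V} (h : Λ.Joined₃ i j k) : Λ.Joined j k :=
  let ⟨σ, hσ, _, hj, hk⟩ := h; ⟨σ, hσ, hj, hk⟩

theorem Joined₃.outer {i j k : V} (h : Λ.Joined₃ i j k) : Λ.Joined i k :=
  let ⟨σ, hσ, hi, _, hk⟩ := h; ⟨σ, hσ, hi, hk⟩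

theorem Edge.walk_self {i : V} (h : Λ.Joined i i) :
    Edge.walk (⟨(i, i), h⟩ : Λ.Edge) = SimpleGraph.Walk.nil := by
  simp [Edge.walk]

theorem Edge.walk_of_adj {i j : V} (h : Λ.skeleton.Adj i j) :
    Edge.walk (⟨(i, j), h.2⟩ : Λ.Edge) = .cons h .nil := by
  simp [Edge.walk, h.1]

theorem Edge.walk_append_equiv {i j k : V} (h : Λ.Joined₃ i j k) :
    Λ.EdgePathEquiv ((Edge.walk (⟨(i, j), h.left⟩ : Λ.Edge)).append
      (Edge.walk (⟨(j, k), h.right⟩ : Λ.Edge))) (Edge.walk (⟨(i, k), h.outer⟩ : Λ.Edge)) := by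
  by_cases hij : i = j
  · subst hij
    rw [Edge.walk_self]
    exact .refl _
  by_cases hjk : j = k
  · subst hjk
    rw [Edge.walk_self, SimpleGraph.Walk.append_nil]
    exact .refl _
  have hij' : Λ.skeleton.Adj i j := ⟨hij, h.left⟩
  have hjk' : Λ.skeleton.Adj j k := ⟨hjk, h.right⟩
  rw [Edge.walk_of_adj hij', Edge.walk_of_adj hjk']
  by_cases hik : i = k
  · subst hik
    rw [Edge.walk_self]
    exact .backtrack hij'
  · have hik' : Λ.skeleton.Adj i k := ⟨hik, h.outer⟩
    rw [Edge.walk_of_adj hik']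
    exact .triangle hij' hjk' hik' h

theorem edgeLoopClass_mul {i₀ : V} (p r : Λ.skeleton.Walk i₀ i₀) :
    Λ.edgeLoopClass p * Λ.edgeLoopClass r = Λ.edgeLoopClass (p.append r) := rfl

theorem edgeLoopClass_nil {i₀ : V} :
    Λ.edgeLoopClass (.nil : Λ.skeleton.Walk i₀ i₀) = 1 := rfl

theorem edgeLoopClass_eq_iff {i₀ : V} {p r : Λ.skeleton.Walk i₀ i₀} :
    Λ.edgeLoopClass p = Λ.edgeLoopClass r ↔ Λ.EdgePathEquiv p r :=
  ⟨fun h => Quotient.exact h, fun h => Quotient.sound h⟩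

theorem EdgePathEquiv.append_reverse_self {i j : V} (p : Λ.skeleton.Walk i j) :
    Λ.EdgePathEquiv (p.append p.reverse) .nil := by
  simpa using EdgePathEquiv.reverse_append_self p.reverse

namespace RootedTree

variable (T : Λ.RootedTree)

theorem γ_mul {i j k : V} (h : Λ.Joined₃ i j k) :
    T.γ ⟨(i, j), h.left⟩ * T.γ ⟨(j, k), h.right⟩ = T.γ ⟨(i, k), h.outer⟩ := by
  refine (edgeLoopClass_mul _ _).trans (edgeLoopClass_eq_iff.2 ?_)
  have h1 := EdgePathEquiv.append (.append (.refl (T.path i))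
    (.append (.refl (Edge.walk (⟨(i, j), h.left⟩ : Λ.Edge)))
      (.append (EdgePathEquiv.reverse_append_self (T.path j))
        (.refl (Edge.walk (⟨(j, k), h.right⟩ : Λ.Edge)))))) (.refl (T.path k).reverse)
  have h2 := EdgePathEquiv.append (.append (.refl (T.path i)) (Edge.walk_append_equiv h))
    (.refl (T.path k).reverse)
  refine .trans ?_ h2
  simpa [SimpleGraph.Walk.append_assoc] using h1

theorem γ_self {i : V} (h : Λ.Joined i i) : T.γ ⟨(i, i), h⟩ = 1 := by
  refine Eq.trans (edgeLoopClass_eq_iff.2 ?_) edgeLoopClass_nil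
  simp only [Edge.walk_self, SimpleGraph.Walk.append_nil]
  exact .append_reverse_self _

theorem γ_symm {i j : V} (h : Λ.Joined i j) : T.γ ⟨(j, i), h.symm⟩ = (T.γ ⟨(i, j), h⟩)⁻¹ := by
  obtain ⟨σ, hσ, hi, hj⟩ := h
  have h3 : Λ.Joined₃ j i j := ⟨σ, hσ, hj, hi, hj⟩
  rw [eq_inv_iff_mul_eq_one]
  exact (T.γ_mul h3).trans (T.γ_self h3.outer)

theorem inv_mem_generators {γ : T.Γ} (h : γ ∈ T.generators) : γ⁻¹ ∈ T.generators := by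
  obtain ⟨⟨⟨i, j⟩, hij⟩, rfl⟩ := h
  exact ⟨_, T.γ_symm hij⟩

/-- Along an edge of the tree one of the two tree paths extends the other, so `γ_{ij} = 1`. -/
theorem γ_of_tree_adj {i j : V} (h : T.tree.Adj i j) :
    T.γ ⟨(i, j), (T.le_skeleton h).2⟩ = 1 := by
  have key : ∀ {i j : V} (h : T.tree.Adj i j),
      i ∈ (T.isTree.existsUnique_path T.root j).choose.support →
      T.γ ⟨(i, j), (T.le_skeleton h).2⟩ = 1 := by
    intro i j h hs
    have hp := T.isTree.isAcyclic.path_concat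
      (T.isTree.existsUnique_path T.root i).choose_spec.1
      (T.isTree.existsUnique_path T.root j).choose_spec.1 h hs
    have hpj : T.path j = (T.path i).append (.cons (T.le_skeleton h) .nil) := by
      rw [path, hp, SimpleGraph.Walk.concat_eq_append, SimpleGraph.Walk.mapLe_append]
      rfl
    refine Eq.trans (edgeLoopClass_eq_iff.2 ?_) edgeLoopClass_nil
    simp only [Edge.walk_of_adj (T.le_skeleton h)]
    rw [← hpj]
    exact .append_reverse_self _
  by_cases hs : i ∈ (T.isTree.existsUnique_path T.root j).choose.support
  · exact key h hs
  · have h1 := T.isTree.isAcyclic.mem_support_of_ne_mem_support_of_adj_of_isPath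
      (T.isTree.existsUnique_path T.root i).choose_spec.1
      (T.isTree.existsUnique_path T.root j).choose_spec.1 h hs
    have h2 := key h.symm h1
    have h3 := T.γ_symm (T.le_skeleton h).2
    rw [h2] at h3
    exact inv_eq_one.1 h3.symm

end RootedTree

end EdgePaths

section AlongWalk

variable {V : Type*} [Fintype V] {Λ : AbstractSimplicialComplex V}
variable {A : Type*} [CStarAlgebra A]

namespace CoordBundle

variable (v : Λ.CoordBundle A)

theorem atBary_symm {i j : V} (h : Λ.skeleton.Adj i j) :
    v.atBary h.symm = (v.atBary h)⁻¹ := by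
  have hb : edgeBarycenter j i = edgeBarycenter i j := by
    classical
    funext k; unfold edgeBarycenter; exact if_congr or_comm rfl rfl
  have := v.inv_eq j i h.symm (edgeBarycenter j i) (edgeBarycenter_mem h.symm).1
    (edgeBarycenter_mem h.symm).2
  simp only [atBary]
  rw [this]
  congr 3

theorem alongWalk_nil {i : V} : v.alongWalk (.nil : Λ.skeleton.Walk i i) = 1 := rfl

theorem alongWalk_cons {i j k : V} (h : Λ.skeleton.Adj i j) (p : Λ.skeleton.Walk j k) :
    v.alongWalk (.cons h p) = v.atBary h * v.alongWalk p := by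
  simp [alongWalk]

theorem alongWalk_edge_walk {i j : V} (h : Λ.skeleton.Adj i j) :
    v.alongWalk (Edge.walk (⟨(i, j), h.2⟩ : Λ.Edge)) = v.atBary h :=
  (congrArg v.alongWalk (Edge.walk_of_adj h)).trans
    ((v.alongWalk_cons h .nil).trans (mul_one _))

theorem alongWalk_edge_walk_self {i : V} (h : Λ.Joined i i) :
    v.alongWalk (Edge.walk (⟨(i, i), h⟩ : Λ.Edge)) = 1 :=
  congrArg v.alongWalk (Edge.walk_self h)

theorem alongWalk_append {i j k : V} (p : Λ.skeleton.Walk i j) (r : Λ.skeleton.Walk j k) :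
    v.alongWalk (p.append r) = v.alongWalk p * v.alongWalk r := by
  simp [alongWalk, SimpleGraph.Walk.darts_append]

theorem alongWalk_reverse {i j : V} (p : Λ.skeleton.Walk i j) :
    v.alongWalk p.reverse = (v.alongWalk p)⁻¹ := by
  induction p with
  | nil => simp [alongWalk_nil]
  | cons h p ih =>
    rw [SimpleGraph.Walk.reverse_cons, alongWalk_append, ih, alongWalk_cons, alongWalk_cons,
      alongWalk_nil, mul_one, atBary_symm, mul_inv_rev]

end CoordBundle

end AlongWalk

/-- Every word in the edges is represented by an edge loop, whose class is the image of the word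
in `Γ`, and along which every coordinate bundle has the holonomy prescribed by the word. -/
theorem RootedTree.exists_loop_of_word {V : Type*} [Fintype V] {Λ : AbstractSimplicialComplex V}
    (T : Λ.RootedTree) (w : FreeGroup Λ.Edge) :
    ∃ p : Λ.skeleton.Walk T.root T.root, Λ.edgeLoopClass p = T.q w ∧
      ∀ (A : Type u) [CStarAlgebra A] (v : Λ.CoordBundle A), v.lift T w = v.alongWalk p := by
  have hof : ∀ e : Λ.Edge, ∃ p : Λ.skeleton.Walk T.root T.root,
      Λ.edgeLoopClass p = T.q (FreeGroup.of e) ∧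
      ∀ (A : Type u) [CStarAlgebra A] (v : Λ.CoordBundle A),
        v.lift T (FreeGroup.of e) = v.alongWalk p := by
    intro e
    refine ⟨((T.path e.1.1).append e.walk).append (T.path e.1.2).reverse, ?_, ?_⟩
    · rw [RootedTree.q, FreeGroup.lift_apply_of]; rfl
    · intro A _ v
      rw [CoordBundle.lift, FreeGroup.lift_apply_of, CoordBundle.alongWalk_append,
        CoordBundle.alongWalk_append, CoordBundle.alongWalk_reverse]
  induction w using FreeGroup.induction_on with
  | C1 => exact ⟨.nil, by rw [map_one]; rfl, fun A _ v => by rw [map_one]; rfl⟩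
  | of e => exact hof e
  | inv_of e _ =>
    obtain ⟨p, hp, hv⟩ := hof e
    exact ⟨p.reverse, by rw [map_inv, ← hp]; rfl,
      fun A _ v => by rw [map_inv, hv, CoordBundle.alongWalk_reverse]⟩
  | mul x y hx hy =>
    obtain ⟨p, hp, hv⟩ := hx
    obtain ⟨r, hr, hv'⟩ := hy
    exact ⟨p.append r, by rw [map_mul, ← hp, ← hr]; rfl,
      fun A _ v => by rw [map_mul, hv, hv', CoordBundle.alongWalk_append]⟩

/-! ### Holonomy of nearly flat bundles -/

section Flat

variable {V : Type*} [Fintype V] {Λ : AbstractSimplicialComplex V}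

open Classical in
/-- The barycenter of a simplex belongs to the dual cells of all its vertices. -/
theorem exists_mem_dualCell_of_face {σ : Finset V} (hσ : σ ∈ Λ.faces) :
    ∃ t : V → ℝ, ∀ i ∈ σ, t ∈ Λ.dualCell i := by
  have hne : σ.Nonempty := (Λ.isRelLowerSet_faces hσ).1
  have hpos : (0 : ℝ) < σ.card := by exact_mod_cast hne.card_pos
  refine ⟨fun k => if k ∈ σ then (σ.card : ℝ)⁻¹ else 0, fun i hi => Λ.mem_dualCell.2
    ⟨⟨fun k => ?_, ?_, σ, hσ, fun k hk => if_neg hk⟩, fun k => ?_⟩⟩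
  · dsimp only; split_ifs <;> positivity
  · simp [hpos.ne']
  · simp only [hi, if_true]; split_ifs
    · exact le_rfl
    · positivity

variable {A : Type*} [CStarAlgebra A]

namespace CoordBundle

variable {v : Λ.CoordBundle A} {ε : ℝ}

theorem IsFlat.norm_fn_le (hv : v.IsFlat ε) (hε : ε ≤ 1) {i j : V} (h : Λ.skeleton.Adj i j)
    (x : Λ.dualCell₂ i j) : ‖(v.fn i j h x : A)‖ ≤ 2 :=
  (norm_le_of_mem_nearUnitary (hv.near i j h x)).trans (by linarith)

theorem IsFlat.norm_alongWalk_le (hv : v.IsFlat ε) (hε : ε ≤ 1) {i j : V}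
    (p : Λ.skeleton.Walk i j) : ‖(v.alongWalk p : A)‖ ≤ 2 ^ p.length := by
  induction p with
  | nil => simpa [alongWalk_nil] using norm_one_le_one (A := A)
  | cons h p ih =>
    rw [alongWalk_cons, Units.val_mul, SimpleGraph.Walk.length_cons, pow_succ']
    exact (norm_mul_le _ _).trans
      (mul_le_mul (hv.norm_fn_le hε h _) ih (norm_nonneg _) (by norm_num))

/-- The cocycle identity holds at the barycenter of the triangle, hence approximately for the values
at the barycenters of the edges. -/
theorem IsFlat.norm_atBary_mul_sub_le (hv : v.IsFlat ε) (hε : ε ≤ 1) {i j k : V}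
    (hij : Λ.skeleton.Adj i j) (hjk : Λ.skeleton.Adj j k) (hik : Λ.skeleton.Adj i k)
    (h : Λ.Joined₃ i j k) :
    ‖(v.atBary hij : A) * v.atBary hjk - v.atBary hik‖ ≤ 5 * ε := by
  have h' := h
  obtain ⟨σ, hσ, hi, hj, hk⟩ := h'
  obtain ⟨t, ht⟩ := exists_mem_dualCell_of_face hσ
  have hc := congrArg (Units.val) (v.cocycle i j k hij hjk hik h t (ht i hi) (ht j hj) (ht k hk))
  rw [Units.val_mul] at hc
  have h1 := norm_mul_sub_mul_le (v.atBary hij : A) (v.atBary hjk)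
    (v.fn i j hij ⟨t, ht i hi, ht j hj⟩) (v.fn j k hjk ⟨t, ht j hj, ht k hk⟩)
  rw [← hc] at h1
  have h2 := hv.flat i j hij ⟨edgeBarycenter i j, edgeBarycenter_mem hij⟩ ⟨t, ht i hi, ht j hj⟩
  have h3 := hv.flat j k hjk ⟨edgeBarycenter j k, edgeBarycenter_mem hjk⟩ ⟨t, ht j hj, ht k hk⟩
  have h4 := hv.flat i k hik ⟨t, ht i hi, ht k hk⟩ ⟨edgeBarycenter i k, edgeBarycenter_mem hik⟩
  have h5 := hv.norm_fn_le hε hjk ⟨edgeBarycenter j k, edgeBarycenter_mem hjk⟩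
  have h6 := hv.norm_fn_le hε hij ⟨t, ht i hi, ht j hj⟩
  have h7 := norm_sub_le_norm_sub_add_norm_sub ((v.atBary hij : A) * v.atBary hjk)
    (v.fn i k hik ⟨t, ht i hi, ht k hk⟩) (v.atBary hik)
  change ‖(v.atBary hij : A) - _‖ < ε at h2
  change ‖(v.atBary hjk : A) - _‖ < ε at h3
  change ‖_ - (v.atBary hik : A)‖ < ε at h4
  change ‖(v.atBary hjk : A)‖ ≤ 2 at h5
  have h8 := mul_le_mul h2.le h5 (norm_nonneg _) ((norm_nonneg _).trans h2.le)
  have h9 := mul_le_mul h6 h3.le (norm_nonneg _) (by norm_num)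
  linarith

end CoordBundle

/-- Equivalent edge paths have nearly equal holonomies in a nearly flat bundle, with a constant that
depends on the chain of elementary moves between them only. -/
theorem EdgePathEquiv.exists_norm_alongWalk_sub_le {i j : V} {p p' : Λ.skeleton.Walk i j}
    (h : Λ.EdgePathEquiv p p') :
    ∃ C : ℝ, 0 ≤ C ∧ ∀ (A : Type u) [CStarAlgebra A] (v : Λ.CoordBundle A) (ε : ℝ), 0 ≤ ε → ε ≤ 1 →
      v.IsFlat ε → ‖(v.alongWalk p : A) - v.alongWalk p'‖ ≤ C * ε := by
  induction h with
  | refl p => exact ⟨0, le_rfl, fun A _ v ε _ _ _ => by simp⟩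
  | symm _ ih =>
    obtain ⟨C, hC, hb⟩ := ih
    exact ⟨C, hC, fun A _ v ε h0 h1 hv => by rw [norm_sub_rev]; exact hb A v ε h0 h1 hv⟩
  | trans _ _ ih ih' =>
    obtain ⟨C, hC, hb⟩ := ih
    obtain ⟨C', hC', hb'⟩ := ih'
    refine ⟨C + C', by positivity, fun A _ v ε h0 h1 hv => ?_⟩
    rw [add_mul]
    exact (norm_sub_le_norm_sub_add_norm_sub _ _ _).trans
      (add_le_add (hb A v ε h0 h1 hv) (hb' A v ε h0 h1 hv))
  | @append i j k p p' r r' _ _ ih ih' =>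
    obtain ⟨C, hC, hb⟩ := ih
    obtain ⟨C', hC', hb'⟩ := ih'
    refine ⟨C * 2 ^ r.length + 2 ^ p'.length * C', by positivity, fun A _ v ε h0 h1 hv => ?_⟩
    rw [CoordBundle.alongWalk_append, CoordBundle.alongWalk_append, Units.val_mul, Units.val_mul]
    refine (norm_mul_sub_mul_le _ _ _ _).trans ?_
    have e1 := mul_le_mul (hb A v ε h0 h1 hv) (hv.norm_alongWalk_le h1 r) (norm_nonneg _)
      (by positivity)
    have e2 := mul_le_mul (hv.norm_alongWalk_le h1 p') (hb' A v ε h0 h1 hv) (norm_nonneg _)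
      (by positivity)
    linarith
  | backtrack h =>
    refine ⟨0, le_rfl, fun A _ v ε _ _ _ => ?_⟩
    rw [CoordBundle.alongWalk_cons, CoordBundle.alongWalk_cons, CoordBundle.atBary_symm _ h]
    simp [CoordBundle.alongWalk_nil]
  | triangle hij hjk hik h =>
    refine ⟨5, by norm_num, fun A _ v ε h0 h1 hv => ?_⟩
    simp only [CoordBundle.alongWalk_cons, CoordBundle.alongWalk_nil, mul_one, Units.val_mul]
    exact hv.norm_atBary_mul_sub_le h1 hij hjk hik h

theorem RootedTree.exists_norm_lift_sub_le (T : Λ.RootedTree) {w w' : FreeGroup Λ.Edge}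
    (h : T.q w = T.q w') :
    ∃ C : ℝ, 0 ≤ C ∧ ∀ (A : Type u) [CStarAlgebra A] (v : Λ.CoordBundle A) (ε : ℝ), 0 ≤ ε → ε ≤ 1 →
      v.IsFlat ε → ‖(v.lift T w : A) - v.lift T w'‖ ≤ C * ε := by
  obtain ⟨p, hp, hv⟩ := T.exists_loop_of_word.{u} w
  obtain ⟨p', hp', hv'⟩ := T.exists_loop_of_word.{u} w'
  rw [← hp, ← hp', edgeLoopClass_eq_iff] at h
  obtain ⟨C, hC, hb⟩ := h.exists_norm_alongWalk_sub_le.{u}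
  exact ⟨C, hC, fun A _ v ε h0 h1 hf => by rw [hv, hv']; exact hb A v ε h0 h1 hf⟩

instance finite_edge : Finite Λ.Edge := inferInstanceAs (Finite {p : V × V // Λ.Joined p.1 p.2})

/-- In a nearly flat bundle `v`, the map `α(v)` nearly agrees with `π̃` on the edges and is nearly
multiplicative on the generators, with a constant common to all bundles. -/
theorem RootedTree.exists_generator_bounds (T : Λ.RootedTree) {s : T.Γ → FreeGroup Λ.Edge}
    (hs : ∀ γ : T.Γ, T.q (s γ) = γ) :
    ∃ C : ℝ, 0 < C ∧ ∀ (A : Type u) [CStarAlgebra A] (v : Λ.CoordBundle A) (ε : ℝ), 0 ≤ ε → ε ≤ 1 →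
      v.IsFlat ε →
      (∀ e : Λ.Edge, ‖(v.alpha T s (T.γ e) : A) - v.lift T (FreeGroup.of e)‖ ≤ C * ε) ∧
      ∀ γ ∈ T.generators, ∀ γ' ∈ T.generators,
        ‖(v.alpha T s (γ * γ') : A) - v.alpha T s γ * v.alpha T s γ'‖ ≤ C * ε := by
  have h1 : ∀ e : Λ.Edge, T.q (s (T.γ e)) = T.q (FreeGroup.of e) := fun e => by
    rw [hs, RootedTree.q, FreeGroup.lift_apply_of]
  have h2 : ∀ e : Λ.Edge × Λ.Edge,
      T.q (s (T.γ e.1 * T.γ e.2)) = T.q (s (T.γ e.1) * s (T.γ e.2)) := fun e => by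
    rw [map_mul, hs, hs, hs]
  choose C hC hb using fun e => T.exists_norm_lift_sub_le.{u} (h1 e)
  choose C' hC' hb' using fun e => T.exists_norm_lift_sub_le.{u} (h2 e)
  obtain ⟨M, hM⟩ := Finite.exists_le C
  obtain ⟨M', hM'⟩ := Finite.exists_le C'
  have l1 : M ≤ max 1 (max M M') := (le_max_left _ _).trans (le_max_right _ _)
  have l2 : M' ≤ max 1 (max M M') := (le_max_right _ _).trans (le_max_right _ _)
  refine ⟨max 1 (max M M'), by positivity, fun A _ v ε h0 h1 hv => ⟨fun e => ?_, ?_⟩⟩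
  · exact (hb e A v ε h0 h1 hv).trans (mul_le_mul_of_nonneg_right ((hM e).trans l1) h0)
  · rintro _ ⟨e, rfl⟩ _ ⟨e', rfl⟩
    have := hb' (e, e') A v ε h0 h1 hv
    rw [map_mul, Units.val_mul] at this
    exact this.trans (mul_le_mul_of_nonneg_right ((hM' (e, e')).trans l2) h0)

/-- In a nearly flat bundle whose transition functions nearly equal `1` on the tree, the homomorphism
`π̃` nearly sends each edge to the value of the transition function. -/
theorem RootedTree.exists_norm_lift_of_sub_le (T : Λ.RootedTree) (K : ℝ) :
    ∃ C : ℝ, 0 ≤ C ∧ ∀ (A : Type u) [CStarAlgebra A] (v : Λ.CoordBundle A) (ε : ℝ), 0 ≤ ε → ε ≤ 1 →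
      v.IsFlat ε → (∀ (i j : V) (h : T.tree.Adj i j),
        ‖(v.atBary (T.le_skeleton h) : A) - 1‖ ≤ K * ε) →
      ∀ e : Λ.Edge, ‖(v.lift T (FreeGroup.of e) : A) - v.alongWalk e.walk‖ ≤ C * ε := by
  have key : ∀ {i j : V} (p : T.tree.Walk i j), ∃ C : ℝ, 0 ≤ C ∧ ∀ (A : Type u) [CStarAlgebra A]
      (v : Λ.CoordBundle A) (ε : ℝ), 0 ≤ ε → ε ≤ 1 → v.IsFlat ε →
      (∀ (i j : V) (h : T.tree.Adj i j), ‖(v.atBary (T.le_skeleton h) : A) - 1‖ ≤ K * ε) →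
      ‖(v.alongWalk (p.mapLe T.le_skeleton) : A) - 1‖ ≤ C * ε := by
    intro i j p
    induction p with
    | nil => exact ⟨0, le_rfl, fun A _ v ε _ _ _ _ => by simp [CoordBundle.alongWalk_nil]⟩
    | @cons a b c h p ih =>
      obtain ⟨C, hC, hb⟩ := ih
      refine ⟨|K| * 2 ^ p.length + C, by positivity, fun A _ v ε h0 h1 hv hK => ?_⟩
      have e0 : v.alongWalk ((SimpleGraph.Walk.cons h p).mapLe T.le_skeleton)
          = v.atBary (T.le_skeleton h) * v.alongWalk (p.mapLe T.le_skeleton) :=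
        v.alongWalk_cons _ _
      have e1 := norm_mul_sub_mul_le (v.atBary (T.le_skeleton h) : A)
        (v.alongWalk (p.mapLe T.le_skeleton)) 1 1
      rw [one_mul] at e1
      have e2 := hb A v ε h0 h1 hv hK
      have e3 := hv.norm_alongWalk_le h1 (p.mapLe T.le_skeleton)
      rw [SimpleGraph.Walk.length_mapLe] at e3
      have e4 := (hK a b h).trans (mul_le_mul_of_nonneg_right (le_abs_self K) h0)
      have e5 := mul_le_mul e4 e3 (norm_nonneg _) (by positivity)
      have e6 := mul_le_mul (norm_one_le_one (A := A)) e2 (norm_nonneg _) (by norm_num)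
      rw [e0, Units.val_mul]
      linarith
  choose C hC hb using fun i => key (T.isTree.existsUnique_path T.root i).choose
  obtain ⟨M, hM⟩ := Finite.exists_le C
  obtain ⟨N, hN⟩ := Finite.exists_le fun i => (T.path i).length
  have hM0 : 0 ≤ M := (hC T.root).trans (hM T.root)
  refine ⟨M * (2 * 2 ^ N) + 2 * (2 ^ N * M), by positivity, fun A _ v ε h0 h1 hv hK => ?_⟩
  rintro ⟨⟨i, j⟩, hij⟩
  set e : Λ.Edge := ⟨(i, j), hij⟩
  have b1 : ∀ i, ‖(v.alongWalk (T.path i) : A) - 1‖ ≤ M * ε := fun i =>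
    (hb i A v ε h0 h1 hv hK).trans (mul_le_mul_of_nonneg_right (hM i) h0)
  have b2 : ‖(v.alongWalk e.walk : A)‖ ≤ 2 := by
    by_cases h : i = j
    · subst h
      have : v.alongWalk e.walk = 1 := v.alongWalk_edge_walk_self hij
      rw [this]
      exact (norm_one_le_one (A := A)).trans (by norm_num)
    · have : v.alongWalk e.walk = v.atBary ⟨h, hij⟩ := v.alongWalk_edge_walk ⟨h, hij⟩
      rw [this]
      exact hv.norm_fn_le h1 _ _
  have b3 : ‖(((v.alongWalk (T.path j))⁻¹ : Aˣ) : A)‖ ≤ 2 ^ N := by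
    rw [← CoordBundle.alongWalk_reverse]
    refine (hv.norm_alongWalk_le h1 _).trans ?_
    rw [SimpleGraph.Walk.length_reverse]
    exact pow_le_pow_right₀ (by norm_num) (hN j)
  have b4 : ‖(((v.alongWalk (T.path j))⁻¹ : Aˣ) : A) - 1‖ ≤ 2 ^ N * (M * ε) := by
    have : (((v.alongWalk (T.path j))⁻¹ : Aˣ) : A) - 1
        = (((v.alongWalk (T.path j))⁻¹ : Aˣ) : A) * (1 - v.alongWalk (T.path j)) := by
      rw [mul_sub, Units.inv_mul, mul_one]
    rw [this]
    refine (norm_mul_le _ _).trans (mul_le_mul b3 ?_ (norm_nonneg _) (by positivity))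
    rw [norm_sub_rev]
    exact b1 j
  have e0 : (v.lift T (FreeGroup.of e) : A) = (v.alongWalk (T.path i) : A) *
      (v.alongWalk e.walk * ((v.alongWalk (T.path j))⁻¹ : Aˣ)) := by
    rw [CoordBundle.lift, FreeGroup.lift_apply_of, Units.val_mul, Units.val_mul, mul_assoc]
  have e1 : (v.lift T (FreeGroup.of e) : A) - v.alongWalk e.walk
      = ((v.alongWalk (T.path i) : A) - 1) *
          (v.alongWalk e.walk * ((v.alongWalk (T.path j))⁻¹ : Aˣ)) +
        v.alongWalk e.walk * ((((v.alongWalk (T.path j))⁻¹ : Aˣ) : A) - 1) := by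
    rw [e0]; noncomm_ring
  rw [e1]
  have c1 : ‖(v.alongWalk e.walk * ((v.alongWalk (T.path j))⁻¹ : Aˣ) : A)‖ ≤ 2 * 2 ^ N :=
    (norm_mul_le _ _).trans (mul_le_mul b2 b3 (norm_nonneg _) (by norm_num))
  have c2 := (norm_mul_le _ _).trans (mul_le_mul (b1 i) c1 (norm_nonneg _) (by positivity))
  have c3 := (norm_mul_le _ _).trans (mul_le_mul b2 b4 (norm_nonneg _) (by norm_num))
  refine (norm_add_le _ _).trans ((add_le_add c2 c3).trans (le_of_eq ?_))
  ring

end Flat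

/-! ### Products along chains of vertices -/

section ListProducts

/-- The product `u_{i₁i₂} u_{i₂i₃} ⋯` along a list is multiplicative under concatenation of lists
that share an end point. -/
theorem prod_zipWith_tail_append {V M : Type*} [Monoid M] (u : V → V → M) (l l' : List V) (j : V) :
    (List.zipWith u (l ++ j :: l') (l ++ j :: l').tail).prod
      = (List.zipWith u (l ++ [j]) (l ++ [j]).tail).prod *
        (List.zipWith u (j :: l') l').prod := by
  induction l with
  | nil => simp
  | cons a l ih =>
    cases l with
    | nil => simp
    | cons b l =>
      simp only [List.cons_append, List.tail_cons, List.zipWith_cons_cons, List.prod_cons] at ih ⊢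
      rw [ih, mul_assoc]

/-- If `u_{ij} u_{jk} ≈ u_{ik}` for contractions `u_{ij}`, then the product of the `u`'s along a list from
`i` to `j` is close to `u_{ij}`: each inner vertex removed costs `η`. -/
theorem norm_prod_zipWith_sub_le {V A : Type*} [NormedRing A] {u : V → V → A} {S : Set V} {η : ℝ}
    (hu : ∀ i ∈ S, ∀ j ∈ S, ‖u i j‖ ≤ 1)
    (h : ∀ i ∈ S, ∀ j ∈ S, ∀ k ∈ S, ‖u i j * u j k - u i k‖ ≤ η) {i j : V} (hi : i ∈ S) (hj : j ∈ S)
    (l : List V) (hl : ∀ k ∈ l, k ∈ S) :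
    ‖(List.zipWith u (i :: (l ++ [j])) (l ++ [j])).prod - u i j‖ ≤ l.length * η := by
  induction l generalizing i with
  | nil => simp
  | cons k l ih =>
    have hk : k ∈ S := hl k (by simp)
    have ih' := ih hk fun m hm => hl m (by simp [hm])
    simp only [List.cons_append, List.zipWith_cons_cons, List.prod_cons]
    set P := (List.zipWith u (k :: (l ++ [j])) (l ++ [j])).prod
    have h1 : u i k * P - u i j = u i k * (P - u k j) + (u i k * u k j - u i j) := by noncomm_ring
    rw [h1, List.length_cons, Nat.cast_add, Nat.cast_one, add_mul, one_mul]
    refine (norm_add_le _ _).trans (add_le_add ?_ (h i hi k hk j hj))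
    refine (norm_mul_le _ _).trans ?_
    have := mul_le_mul (hu i hi k hk) ih' (norm_nonneg _) zero_le_one
    rwa [one_mul] at this

end ListProducts

section Ascending

variable {V : Type*} [PartialOrder V]

theorem ascending_spec {I : Finset V} (h : IsChain (· ≤ ·) (I : Set V)) :
    (ascending I).Pairwise (· < ·) ∧ ∀ k, k ∈ ascending I ↔ k ∈ I := by
  rw [ascending, dif_pos h]
  exact (exists_ascending I h).choose_spec

/-- A strictly increasing list with the elements of `I` is the list `ascending I`. -/
theorem ascending_eq {I : Finset V} {l : List V} (hl : l.Pairwise (· < ·))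
    (hm : ∀ k, k ∈ l ↔ k ∈ I) : ascending I = l := by
  have hchain : IsChain (· ≤ ·) (I : Set V) := by
    intro a ha b hb hne
    have ha' := (hm a).2 ha
    have hb' := (hm b).2 hb
    have : Std.Symm fun x y : V => x ≤ y ∨ y ≤ x := ⟨fun _ _ => Or.symm⟩
    exact List.Pairwise.forall (R := fun x y : V => x ≤ y ∨ y ≤ x) (hl.imp fun h => Or.inl h.le)
      ha' hb' hne
  obtain ⟨h1, h2⟩ := ascending_spec hchain
  have n1 : (ascending I).Nodup := h1.imp fun h => h.ne
  have n2 : l.Nodup := hl.imp fun h => h.ne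
  have hp : (ascending I).Perm l := (List.perm_ext_iff_of_nodup n1 n2).2 fun a => by
    rw [h2, hm]
  exact hp.eq_of_pairwise (fun a b _ _ hab hba => (lt_asymm hab hba).elim) h1 hl

open Classical in
/-- If `j` is the largest element of `I` and the smallest element of `J`, then `I ∪ J` is listed by
joining the lists of `I` and `J` at `j`. -/
theorem exists_ascending_eq_append {I J : Finset V} {j : V}
    (hI : IsChain (· ≤ ·) (I : Set V)) (hJ : IsChain (· ≤ ·) (J : Set V))
    (hjI : j ∈ I) (hjJ : j ∈ J) (hle : ∀ k ∈ I, k ≤ j) (hge : ∀ k ∈ J, j ≤ k) :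
    ∃ l l' : List V, ascending I = l ++ [j] ∧ ascending J = j :: l' ∧
      ascending (I ∪ J) = l ++ j :: l' := by
  obtain ⟨p1, m1⟩ := ascending_spec (I := I.erase j)
    (hI.mono (by simp))
  obtain ⟨p2, m2⟩ := ascending_spec (I := J.erase j)
    (hJ.mono (by simp))
  have lt1 : ∀ k ∈ ascending (I.erase j), k < j := fun k hk => by
    have := Finset.mem_erase.1 ((m1 k).1 hk)
    exact lt_of_le_of_ne (hle k this.2) this.1
  have lt2 : ∀ k ∈ ascending (J.erase j), j < k := fun k hk => by
    have := Finset.mem_erase.1 ((m2 k).1 hk)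
    exact lt_of_le_of_ne (hge k this.2) this.1.symm
  have q2 : (j :: ascending (J.erase j)).Pairwise (· < ·) := List.pairwise_cons.2 ⟨lt2, p2⟩
  refine ⟨ascending (I.erase j), ascending (J.erase j), ascending_eq ?_ ?_, ascending_eq q2 ?_,
    ascending_eq ?_ ?_⟩
  · refine List.pairwise_append.2 ⟨p1, List.pairwise_singleton _ _, fun a ha b hb => ?_⟩
    rw [List.mem_singleton.1 hb]
    exact lt1 a ha
  · intro k
    simp only [List.mem_append, m1, Finset.mem_erase, List.mem_singleton]
    grind
  · intro k
    simp only [List.mem_cons, m2, Finset.mem_erase]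
    grind
  · refine List.pairwise_append.2 ⟨p1, q2, fun a ha b hb => ?_⟩
    rcases List.mem_cons.1 hb with rfl | hb
    · exact lt1 a ha
    · exact (lt1 a ha).trans (lt2 b hb)
  · intro k
    simp only [List.mem_append, m1, m2, Finset.mem_erase, List.mem_cons, Finset.mem_union]
    grind

open Classical in
theorem exists_ascending_eq_cons_append {I : Finset V} {i j : V} (hij : i < j)
    (hI : IsChain (· ≤ ·) (I : Set V)) (hi : i ∈ I) (hj : j ∈ I) (hle : ∀ k ∈ I, i ≤ k ∧ k ≤ j) :
    ∃ l : List V, ascending I = i :: (l ++ [j]) ∧ (∀ k ∈ l, k ∈ I) ∧ l.length ≤ I.card := by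
  obtain ⟨p, m⟩ := ascending_spec (I := (I.erase i).erase j)
    (hI.mono fun k hk => Finset.mem_of_mem_erase (Finset.mem_of_mem_erase hk))
  have hmem : ∀ k ∈ ascending ((I.erase i).erase j), k ∈ I ∧ i < k ∧ k < j := fun k hk => by
    have h1 := Finset.mem_erase.1 ((m k).1 hk)
    have h2 := Finset.mem_erase.1 h1.2
    have h3 := hle k h2.2
    exact ⟨h2.2, lt_of_le_of_ne h3.1 h2.1.symm, lt_of_le_of_ne h3.2 h1.1⟩
  refine ⟨ascending ((I.erase i).erase j), ascending_eq ?_ ?_, fun k hk => (hmem k hk).1, ?_⟩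
  · refine List.pairwise_cons.2 ⟨fun k hk => ?_, List.pairwise_append.2
      ⟨p, List.pairwise_singleton _ _, fun a ha b hb => ?_⟩⟩
    · rcases List.mem_append.1 hk with hk | hk
      · exact (hmem k hk).2.1
      · rwa [List.mem_singleton.1 hk]
    · rw [List.mem_singleton.1 hb]
      exact (hmem a ha).2.2
  · intro k
    simp only [List.mem_append, m, Finset.mem_erase, List.mem_cons]
    grind
  · have hn : (ascending ((I.erase i).erase j)).Nodup := p.imp fun h => h.ne
    rw [← List.toFinset_card_of_nodup hn]
    exact Finset.card_le_card fun k hk => (hmem k (List.mem_toFinset.1 hk)).1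

end Ascending

/-! ### The interpolating functions -/

section Weights

variable {V : Type*}

open Classical in
/-- Expanding `∏ (f k + (1 - f k)) = 1`; the sets that miss `i` or `j` have weight `0`. -/
theorem sum_weights_eq_one {S : Finset V} {i j : V} (hi : i ∈ S) (hj : j ∈ S) {f : V → ℝ}
    (hfi : f i = 1) (hfj : f j = 1) :
    ∑ I ∈ S.powerset.filter (fun I => i ∈ I ∧ j ∈ I),
      ∏ k ∈ S, (if k ∈ I then f k else 1 - f k) = 1 := by
  have h1 : ∑ I ∈ S.powerset, ∏ k ∈ S, (if k ∈ I then f k else 1 - f k) = 1 := by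
    have h2 := Finset.prod_add f (fun k => 1 - f k) S
    simp only [add_sub_cancel, Finset.prod_const_one] at h2
    refine Eq.trans ?_ h2.symm
    refine Finset.sum_congr rfl fun I hI => ?_
    have h3 := Finset.prod_piecewise S I f (fun k => 1 - f k)
    rw [Finset.inter_eq_right.2 (Finset.mem_powerset.1 hI)] at h3
    exact h3
  refine Eq.trans ?_ h1
  refine Finset.sum_filter_of_ne fun I _ hne => ?_
  constructor
  · by_contra h
    exact hne (Finset.prod_eq_zero hi (by rw [if_neg h, hfi, sub_self]))
  · by_contra h
    exact hne (Finset.prod_eq_zero hj (by rw [if_neg h, hfj, sub_self]))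

end Weights

section BlockFun

variable {V : Type*} [PartialOrder V] {Λ : AbstractSimplicialComplex V}
variable {A : Type*} [CStarAlgebra A]

namespace RootedTree

variable (T : Λ.RootedTree) (π : T.Γ → Aˣ)

open Classical in
/-- Vertices whose barycentric coordinate vanishes do not contribute to `blockFun`. -/
theorem blockFun_eq_of_subset {σ τ : Finset V} (h : τ ⊆ σ) {t : V → ℝ}
    (ht : ∀ k, k ∉ τ → t k = 0) (i j : V) :
    T.blockFun π σ i j t = T.blockFun π τ i j t := by
  unfold blockFun
  have hsub : (τ.filter fun k => i ≤ k ∧ k ≤ j) ⊆ σ.filter fun k => i ≤ k ∧ k ≤ j :=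
    Finset.filter_subset_filter _ h
  have hz : ∀ k ∈ σ.filter (fun k => i ≤ k ∧ k ≤ j), k ∉ τ.filter (fun k => i ≤ k ∧ k ≤ j) →
      t k = 0 := fun k hk hk' => ht k fun hkτ =>
    hk' (Finset.mem_filter.2 ⟨hkτ, (Finset.mem_filter.1 hk).2⟩)
  symm
  refine Finset.sum_subset_zero_on_sdiff ?_ ?_ ?_
  · exact Finset.filter_subset_filter _ (Finset.powerset_mono.2 hsub)
  · intro I hI
    rw [Finset.mem_sdiff, Finset.mem_filter, Finset.mem_filter, Finset.mem_powerset,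
      Finset.mem_powerset] at hI
    have hn : ¬ I ⊆ τ.filter fun k => i ≤ k ∧ k ≤ j := fun h' => hI.2 ⟨h', hI.1.2⟩
    obtain ⟨k, hkI, hk⟩ := Finset.not_subset.1 hn
    rw [Finset.prod_eq_zero (hI.1.1 hkI), zero_smul]
    rw [if_pos hkI, hz k (hI.1.1 hkI) hk, zero_div]
  · intro I hI
    rw [Finset.mem_filter, Finset.mem_powerset] at hI
    congr 1
    refine Finset.prod_subset hsub fun k hk hk' => ?_
    rw [if_neg fun h' => hk' (hI.1 h'), hz k hk hk', zero_div, sub_zero]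

open Classical in
/-- `blockFun` is a convex combination of products `u_I`, each of which is close to `u_{ij}`. -/
theorem norm_blockFun_sub_le {σ : Finset V} (hσ : IsChain (· ≤ ·) (σ : Set V)) {η : ℝ} (hη : 0 ≤ η)
    (hu : ∀ i ∈ σ, ∀ j ∈ σ, ‖T.u π i j‖ ≤ 1)
    (h : ∀ i ∈ σ, ∀ j ∈ σ, ∀ k ∈ σ, ‖T.u π i j * T.u π j k - T.u π i k‖ ≤ η)
    {i j : V} (hi : i ∈ σ) (hj : j ∈ σ) (hij : i < j) {t : V → ℝ} (h0 : ∀ k, 0 ≤ t k)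
    (hle : ∀ k, t k ≤ t i) (hpos : 0 < t i) (htj : t j = t i) :
    ‖T.blockFun π σ i j t - T.u π i j‖ ≤ σ.card * η := by
  unfold blockFun
  set S := σ.filter fun k => i ≤ k ∧ k ≤ j with hS
  have hiS : i ∈ S := Finset.mem_filter.2 ⟨hi, le_rfl, hij.le⟩
  have hjS : j ∈ S := Finset.mem_filter.2 ⟨hj, hij.le, le_rfl⟩
  have hsum := sum_weights_eq_one hiS hjS (f := fun k => t k / t i) (div_self hpos.ne')
    (by rw [htj, div_self hpos.ne'])
  have hw : ∀ I : Finset V, 0 ≤ ∏ k ∈ S, (if k ∈ I then t k / t i else 1 - t k / t i) := by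
    intro I
    refine Finset.prod_nonneg fun k _ => ?_
    split_ifs
    · exact div_nonneg (h0 k) hpos.le
    · rw [sub_nonneg, div_le_one hpos]; exact hle k
  have hpath : ∀ I ∈ S.powerset.filter (fun I => i ∈ I ∧ j ∈ I),
      ‖T.uPath π I - T.u π i j‖ ≤ σ.card * η := by
    intro I hI
    rw [Finset.mem_filter, Finset.mem_powerset] at hI
    have hIσ : I ⊆ σ := hI.1.trans (Finset.filter_subset _ _)
    obtain ⟨l, hl, hlI, hcard⟩ := exists_ascending_eq_cons_append hij
      (hσ.mono (by exact_mod_cast hIσ)) hI.2.1 hI.2.2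
      fun k hk => (Finset.mem_filter.1 (hI.1 hk)).2
    rw [uPath, hl, List.tail_cons]
    refine (norm_prod_zipWith_sub_le (S := (σ : Set V)) hu h hi hj l
      fun k hk => hIσ (hlI k hk)).trans (mul_le_mul_of_nonneg_right ?_ hη)
    exact_mod_cast hcard.trans (Finset.card_le_card hIσ)
  have hone : T.u π i j = ∑ I ∈ S.powerset.filter (fun I => i ∈ I ∧ j ∈ I),
      (∏ k ∈ S, (if k ∈ I then t k / t i else 1 - t k / t i)) • T.u π i j := by
    rw [← Finset.sum_smul, hsum, one_smul]
  rw [hone, ← Finset.sum_sub_distrib]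
  refine (norm_sum_le _ _).trans ?_
  refine le_of_le_of_eq ?_ ((congrArg (· * ((σ.card : ℝ) * η)) hsum).trans (one_mul _))
  rw [Finset.sum_mul]
  refine Finset.sum_le_sum fun I hI => ?_
  rw [← smul_sub, norm_smul, Real.norm_of_nonneg (hw I)]
  exact mul_le_mul_of_nonneg_left (hpath I hI) (hw I)

theorem uPath_union [DecidableEq V] {I J : Finset V} {j : V}
    (hI : IsChain (· ≤ ·) (I : Set V)) (hJ : IsChain (· ≤ ·) (J : Set V))
    (hjI : j ∈ I) (hjJ : j ∈ J) (hle : ∀ k ∈ I, k ≤ j) (hge : ∀ k ∈ J, j ≤ k) :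
    T.uPath π (I ∪ J) = T.uPath π I * T.uPath π J := by
  obtain ⟨l, l', h1, h2, h3⟩ := exists_ascending_eq_append hI hJ hjI hjJ hle hge
  have h3' : ascending (I ∪ J) = l ++ j :: l' := by convert h3
  rw [uPath, uPath, uPath, h1, h2, h3', prod_zipWith_tail_append, List.tail_cons]

open Classical in
/-- At points where the coordinates of `i < j < k` agree, only the sets `I ∋ j` contribute to
`blockFun π σ i k`, and these are the unions of a set from `i` to `j` and a set from `j` to `k`. -/
theorem blockFun_mul_blockFun {σ : Finset V} (hσ : IsChain (· ≤ ·) (σ : Set V)) {i j k : V}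
    (hj : j ∈ σ) (hij : i < j) (hjk : j < k)
    {t : V → ℝ} (hpos : t i ≠ 0) (htj : t j = t i) :
    T.blockFun π σ i k t = T.blockFun π σ i j t * T.blockFun π σ j k t := by
  unfold blockFun
  rw [htj]
  set f : V → ℝ := fun m => t m / t i with hf
  have hfj : f j = 1 := by rw [hf]; dsimp only; rw [htj, div_self hpos]
  change (∑ I ∈ _, (∏ m ∈ _, if m ∈ I then f m else 1 - f m) • _)
    = (∑ I ∈ _, (∏ m ∈ _, if m ∈ I then f m else 1 - f m) • _) *
      ∑ I ∈ _, (∏ m ∈ _, if m ∈ I then f m else 1 - f m) • _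
  set S := σ.filter fun m => i ≤ m ∧ m ≤ k with hS
  set S₁ := σ.filter fun m => i ≤ m ∧ m ≤ j with hS₁
  set S₂ := σ.filter fun m => j ≤ m ∧ m ≤ k with hS₂
  have m0 : ∀ m, m ∈ S ↔ m ∈ σ ∧ i ≤ m ∧ m ≤ k := fun m => Finset.mem_filter
  have m1 : ∀ m, m ∈ S₁ ↔ m ∈ σ ∧ i ≤ m ∧ m ≤ j := fun m => Finset.mem_filter
  have m2 : ∀ m, m ∈ S₂ ↔ m ∈ σ ∧ j ≤ m ∧ m ≤ k := fun m => Finset.mem_filter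
  have hun : S₁ ∪ S₂ = S := by
    ext m
    rw [Finset.mem_union, m0, m1, m2]
    constructor
    · rintro (⟨h1, h2, h3⟩ | ⟨h1, h2, h3⟩)
      · exact ⟨h1, h2, h3.trans hjk.le⟩
      · exact ⟨h1, hij.le.trans h2, h3⟩
    · rintro ⟨h1, h2, h3⟩
      rcases eq_or_ne m j with rfl | hne
      · exact Or.inl ⟨h1, h2, le_rfl⟩
      · rcases hσ h1 hj hne with h | h
        · exact Or.inl ⟨h1, h2, h⟩
        · exact Or.inr ⟨h1, h, h3⟩
  have hint : S₁ ∩ S₂ = {j} := by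
    ext m
    rw [Finset.mem_inter, m1, m2, Finset.mem_singleton]
    constructor
    · rintro ⟨⟨-, -, h1⟩, -, h2, -⟩
      exact le_antisymm h1 h2
    · rintro rfl
      exact ⟨⟨hj, hij.le, le_rfl⟩, hj, le_rfl, hjk.le⟩
  have hjS : j ∈ S := (m0 j).2 ⟨hj, hij.le, hjk.le⟩
  rw [Finset.sum_mul_sum, ← Finset.sum_product']
  -- Sets that miss `j` have weight `0`, since `f j = 1`; the others split at `j`.
  have hdrop : ∑ I ∈ S.powerset.filter (fun I => i ∈ I ∧ k ∈ I),
      (∏ m ∈ S, if m ∈ I then f m else 1 - f m) • T.uPath π I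
      = ∑ I ∈ (S.powerset.filter (fun I => i ∈ I ∧ k ∈ I)).filter (fun I => j ∈ I),
      (∏ m ∈ S, if m ∈ I then f m else 1 - f m) • T.uPath π I := by
    symm
    refine Finset.sum_filter_of_ne fun I _ hne => ?_
    by_contra h
    refine hne ?_
    rw [Finset.prod_eq_zero hjS (by rw [if_neg h, hfj, sub_self]), zero_smul]
  rw [hdrop]
  refine Finset.sum_bij' (fun I _ => (I ∩ S₁, I ∩ S₂)) (fun P _ => P.1 ∪ P.2) ?_ ?_ ?_ ?_ ?_
  · intro I hI
    simp only [Finset.mem_filter, Finset.mem_powerset, Finset.mem_product, Finset.mem_inter] at hI ⊢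
    obtain ⟨⟨hIS, hiI, hkI⟩, hjI⟩ := hI
    have := (m0 i).1 (hIS hiI)
    have := (m0 k).1 (hIS hkI)
    refine ⟨⟨Finset.inter_subset_right, ⟨hiI, (m1 i).2 ⟨?_, le_rfl, hij.le⟩⟩, hjI,
      (m1 j).2 ⟨hj, hij.le, le_rfl⟩⟩, Finset.inter_subset_right, ⟨hjI,
      (m2 j).2 ⟨hj, le_rfl, hjk.le⟩⟩, hkI, (m2 k).2 ⟨?_, hjk.le, le_rfl⟩⟩ <;> tauto
  · rintro ⟨I, J⟩ hP
    simp only [Finset.mem_filter, Finset.mem_powerset, Finset.mem_product, Finset.mem_union] at hP ⊢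
    obtain ⟨⟨hI, hiI, hjI⟩, hJ, hjJ, hkJ⟩ := hP
    exact ⟨⟨hun ▸ Finset.union_subset_union hI hJ, Or.inl hiI, Or.inr hkJ⟩, Or.inl hjI⟩
  · intro I hI
    simp only [Finset.mem_filter, Finset.mem_powerset] at hI
    dsimp only
    rw [← Finset.inter_union_distrib_left, hun, Finset.inter_eq_left.2 hI.1.1]
  · rintro ⟨I, J⟩ hP
    simp only [Finset.mem_filter, Finset.mem_powerset, Finset.mem_product] at hP
    obtain ⟨⟨hI, hiI, hjI⟩, hJ, hjJ, hkJ⟩ := hP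
    have e1 : ∀ m ∈ J, m ∈ S₁ → m ∈ I := fun m hm hm' => by
      have : m ∈ S₁ ∩ S₂ := Finset.mem_inter.2 ⟨hm', hJ hm⟩
      rw [hint, Finset.mem_singleton] at this
      exact this ▸ hjI
    have e2 : ∀ m ∈ I, m ∈ S₂ → m ∈ J := fun m hm hm' => by
      have : m ∈ S₁ ∩ S₂ := Finset.mem_inter.2 ⟨hI hm, hm'⟩
      rw [hint, Finset.mem_singleton] at this
      exact this ▸ hjJ
    refine Prod.ext ?_ ?_
    · ext m
      simp only [Finset.mem_inter, Finset.mem_union]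
      exact ⟨fun h => h.1.elim id fun h' => e1 m h' h.2, fun h => ⟨Or.inl h, hI h⟩⟩
    · ext m
      simp only [Finset.mem_inter, Finset.mem_union]
      exact ⟨fun h => h.1.elim (fun h' => e2 m h' h.2) id, fun h => ⟨Or.inr h, hJ h⟩⟩
  · intro I hI
    simp only [Finset.mem_filter, Finset.mem_powerset] at hI
    obtain ⟨⟨hIS, hiI, hkI⟩, hjI⟩ := hI
    have hIσ : ∀ {J : Finset V}, I ∩ J ⊆ σ := fun {J} m hm =>
      ((m0 m).1 (hIS (Finset.mem_inter.1 hm).1)).1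
    have hI12 : (I ∩ S₁) ∪ (I ∩ S₂) = I := by
      rw [← Finset.inter_union_distrib_left, hun, Finset.inter_eq_left.2 hIS]
    have hu := T.uPath_union π (I := I ∩ S₁) (J := I ∩ S₂) (j := j)
      (hσ.mono (by exact_mod_cast hIσ)) (hσ.mono (by exact_mod_cast hIσ))
      (Finset.mem_inter.2 ⟨hjI, (m1 j).2 ⟨hj, hij.le, le_rfl⟩⟩)
      (Finset.mem_inter.2 ⟨hjI, (m2 j).2 ⟨hj, le_rfl, hjk.le⟩⟩)
      (fun m hm => ((m1 m).1 (Finset.mem_inter.1 hm).2).2.2)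
      (fun m hm => ((m2 m).1 (Finset.mem_inter.1 hm).2).2.1)
    rw [hI12] at hu
    rw [hu, smul_mul_smul_comm]
    congr 1
    have p0 := Finset.prod_union_inter (s₁ := S₁) (s₂ := S₂)
      (f := fun m => if m ∈ I then f m else 1 - f m)
    rw [hun, hint, Finset.prod_singleton, if_pos hjI, hfj, mul_one] at p0
    rw [p0]
    congr 1
    · exact Finset.prod_congr rfl fun m hm => by simp only [Finset.mem_inter, hm, and_true]
    · exact Finset.prod_congr rfl fun m hm => by simp only [Finset.mem_inter, hm, and_true]

theorem continuousOn_blockFun (σ : Finset V) (i j : V) :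
    ContinuousOn (T.blockFun π σ i j) {t | t i ≠ 0} := by
  classical
  unfold blockFun
  have hd : ∀ k, ContinuousOn (fun t : V → ℝ => t k / t i) {t | t i ≠ 0} := fun k =>
    (continuous_apply k).continuousOn.div (continuous_apply i).continuousOn fun t ht => ht
  have hf : ∀ (p : Prop) [Decidable p] (k : V),
      ContinuousOn (fun t : V → ℝ => if p then t k / t i else 1 - t k / t i) {t | t i ≠ 0} := by
    intro p _ k
    by_cases hp : p
    · simpa only [if_pos hp] using hd k
    · simp only [if_neg hp]
      exact continuousOn_const.sub (hd k)
  exact continuousOn_finsetSum _ fun I _ =>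
    (continuousOn_finsetProd _ fun k _ => hf _ k).smul continuousOn_const

end RootedTree

end BlockFun

/-! ### Existence of the bundle of a quasi-representation -/

section Beta

variable {V : Type*} {Λ : AbstractSimplicialComplex V} {A : Type*} [CStarAlgebra A]
variable {T : Λ.RootedTree} {π : T.Γ → Aˣ} {δ : ℝ}

namespace RootedTree

theorem u_of_joined {i j : V} (h : Λ.Joined i j) :
    T.u π i j = perturb π (T.γ ⟨(i, j), h⟩) := by
  rw [u, dif_pos h]

theorem u_mem_unitary (hπ : IsQuasiRep T.generators δ π) (hδ : δ ≤ 1 / 16) {i j : V}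
    (h : Λ.Joined i j) : T.u π i j ∈ unitary A := by
  rw [u_of_joined h]
  exact hπ.perturb_mem_unitary hδ ⟨_, rfl⟩ (T.inv_mem_generators ⟨_, rfl⟩)

theorem norm_u_sub_le (hπ : IsQuasiRep T.generators δ π) (hδ : δ ≤ 1 / 16) {i j : V}
    (h : Λ.Joined i j) : ‖T.u π i j - (π (T.γ ⟨(i, j), h⟩) : A)‖ ≤ 15 * δ := by
  rw [u_of_joined h]
  exact hπ.norm_perturb_sub_le hδ ⟨_, rfl⟩ (T.inv_mem_generators ⟨_, rfl⟩)

theorem norm_u_mul_sub_le (hπ : IsQuasiRep T.generators δ π) (hδ : δ ≤ 1 / 16) {i j k : V}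
    (h : Λ.Joined₃ i j k) : ‖T.u π i j * T.u π j k - T.u π i k‖ ≤ 61 * δ := by
  have h1 := norm_u_sub_le hπ hδ h.left
  have h2 := norm_u_sub_le hπ hδ h.right
  have h3 := norm_u_sub_le hπ hδ h.outer
  have h4 := hπ.mul (T.γ ⟨(i, j), h.left⟩) ⟨_, rfl⟩ (T.γ ⟨(j, k), h.right⟩) ⟨_, rfl⟩
  rw [T.γ_mul h] at h4
  set a := (π (T.γ ⟨(i, j), h.left⟩) : A)
  set b := (π (T.γ ⟨(j, k), h.right⟩) : A)
  set c := (π (T.γ ⟨(i, k), h.outer⟩) : A)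
  have h5 := norm_mul_sub_mul_le (T.u π i j) (T.u π j k) a b
  have h6 : ‖T.u π j k‖ ≤ 1 := norm_le_one_of_mem_unitary (u_mem_unitary hπ hδ h.right)
  have h7 : ‖a‖ ≤ 2 :=
    (norm_le_of_mem_nearUnitary (hπ.near _ ⟨_, rfl⟩)).trans (by linarith)
  have h8 := mul_le_mul h1 h6 (norm_nonneg _) ((norm_nonneg _).trans h1)
  have h9 := mul_le_mul h7 h2 (norm_nonneg _) (by norm_num)
  have h10 := norm_sub_le_norm_sub_add_norm_sub (T.u π i j * T.u π j k) (a * b) (T.u π i k)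
  have h11 := norm_sub_le_norm_sub_add_norm_sub (a * b) c (T.u π i k)
  rw [norm_sub_rev] at h3 h4
  linarith

/-- Since `u_{ji} u_{ij} ≈ u_{jj} ≈ π(1) = 1`. -/
theorem norm_u_sub_star_le (hπ : IsQuasiRep T.generators δ π) (hδ : δ ≤ 1 / 16) {i j : V}
    (h : Λ.Joined i j) : ‖T.u π i j - star (T.u π j i)‖ ≤ 76 * δ := by
  obtain ⟨σ, hσ, hi, hj⟩ := h
  have h3 : Λ.Joined₃ j i j := ⟨σ, hσ, hj, hi, hj⟩
  have hu := u_mem_unitary hπ hδ h3.left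
  have h1 := norm_u_mul_sub_le hπ hδ h3
  have h2 := norm_u_sub_le hπ hδ h3.outer
  rw [T.γ_self, hπ.one, Units.val_one] at h2
  have h4 : T.u π i j - star (T.u π j i) = star (T.u π j i) * (T.u π j i * T.u π i j - 1) := by
    rw [mul_sub, ← mul_assoc, Unitary.star_mul_self_of_mem hu, one_mul, mul_one]
  rw [h4, CStarRing.norm_mem_unitary_mul _ (Unitary.star_mem hu)]
  have := norm_sub_le_norm_sub_add_norm_sub (T.u π j i * T.u π i j) (T.u π j j) 1
  linarith

end RootedTree

variable [Fintype V]

open Classical in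
/-- The smallest simplex that contains the point `t`. -/
def carrier (t : V → ℝ) : Finset V := Finset.univ.filter fun k => t k ≠ 0

theorem mem_carrier {t : V → ℝ} {k : V} : k ∈ carrier t ↔ t k ≠ 0 := by
  simp [carrier]

theorem dualCell_pos {t : V → ℝ} {i : V} (h : t ∈ Λ.dualCell i) : 0 < t i := by
  obtain ⟨⟨-, h1, -⟩, hle⟩ := Λ.mem_dualCell.1 h
  by_contra hn
  have : ∑ k, t k ≤ 0 := Finset.sum_nonpos fun k _ => (hle k).trans (not_lt.1 hn)
  linarith

theorem dualCell_eq {t : V → ℝ} {i j : V} (hi : t ∈ Λ.dualCell i) (hj : t ∈ Λ.dualCell j) :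
    t j = t i :=
  le_antisymm ((Λ.mem_dualCell.1 hi).2 j) ((Λ.mem_dualCell.1 hj).2 i)

theorem mem_carrier_of_mem_dualCell {t : V → ℝ} {i : V} (h : t ∈ Λ.dualCell i) : i ∈ carrier t :=
  mem_carrier.2 (dualCell_pos h).ne'

theorem carrier_mem_faces {t : V → ℝ} {i : V} (h : t ∈ Λ.dualCell i) : carrier t ∈ Λ.faces := by
  obtain ⟨⟨-, -, σ, hσ, hs⟩, -⟩ := Λ.mem_dualCell.1 h
  exact face_of_subset hσ (fun k hk => by_contra fun hn => mem_carrier.1 hk (hs k hn))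
    ⟨i, mem_carrier_of_mem_dualCell h⟩

namespace RootedTree

variable [PartialOrder V]

theorem blockFun_eq_carrier {σ : Finset V} {t : V → ℝ} (h : ∀ k, k ∉ σ → t k = 0) (i j : V) :
    T.blockFun π σ i j t = T.blockFun π (carrier t) i j t :=
  T.blockFun_eq_of_subset π (fun k hk => by_contra fun hn => mem_carrier.1 hk (h k hn))
    (fun _ hk => by_contra fun hn => hk (mem_carrier.2 hn)) i j

/-- At `t` only the vertices of the carrier of `t` contribute; these form a chain. -/
theorem norm_blockFun_univ_sub_le (hord : ∀ σ ∈ Λ.faces, IsChain (· ≤ ·) (σ : Set V))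
    (hπ : IsQuasiRep T.generators δ π) (hδ0 : 0 ≤ δ) (hδ : δ ≤ 1 / 16) {i j : V} (hij : i < j)
    {t : V → ℝ} (hi : t ∈ Λ.dualCell i) (hj : t ∈ Λ.dualCell j) :
    ‖T.blockFun π Finset.univ i j t - T.u π i j‖ ≤ Fintype.card V * (61 * δ) := by
  have hσ := carrier_mem_faces hi
  obtain ⟨⟨h0, -, -⟩, hle⟩ := Λ.mem_dualCell.1 hi
  rw [blockFun_eq_carrier (by simp)]
  refine (T.norm_blockFun_sub_le π (hord _ hσ) (η := 61 * δ) (by positivity)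
    (fun a ha b hb => norm_le_one_of_mem_unitary (u_mem_unitary hπ hδ ⟨_, hσ, ha, hb⟩))
    (fun a ha b hb c hc => norm_u_mul_sub_le hπ hδ ⟨_, hσ, ha, hb, hc⟩)
    (mem_carrier_of_mem_dualCell hi) (mem_carrier_of_mem_dualCell hj) hij h0 hle
    (dualCell_pos hi) (dualCell_eq hi hj)).trans
    (mul_le_mul_of_nonneg_right ?_ (by positivity))
  exact_mod_cast Finset.card_le_univ _

variable (T π) in
open Classical in
/-- The value of the function `v_{ij}`, `i < j`, as a unit of `A`; points where it is not invertible
are sent to `1`. The sum is over all vertices of `Λ` rather than those of one simplex: vertices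
outside a simplex that contains `t` have vanishing coordinate and do not contribute. -/
def blockUnit (i j : V) (t : V → ℝ) : Aˣ :=
  if h : IsUnit (T.blockFun π Finset.univ i j t) then h.unit else 1

theorem val_blockUnit (hord : ∀ σ ∈ Λ.faces, IsChain (· ≤ ·) (σ : Set V))
    (hπ : IsQuasiRep T.generators δ π) (hδ0 : 0 ≤ δ) (hδ : δ ≤ 1 / 16)
    (hδ' : Fintype.card V * (61 * δ) ≤ 1 / 2) {i j : V} (hij : i < j)
    {t : V → ℝ} (hi : t ∈ Λ.dualCell i) (hj : t ∈ Λ.dualCell j) :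
    (T.blockUnit π i j t : A) = T.blockFun π Finset.univ i j t := by
  have h1 := norm_blockFun_univ_sub_le hord hπ hδ0 hδ hij hi hj
  have hu : T.u π i j ∈ unitary A := u_mem_unitary hπ hδ
    ⟨_, carrier_mem_faces hi, mem_carrier_of_mem_dualCell hi, mem_carrier_of_mem_dualCell hj⟩
  have h2 : IsUnit (T.blockFun π Finset.univ i j t) :=
    isUnit_of_norm_sub_unitary_lt hu (by linarith)
  rw [blockUnit, dif_pos h2, IsUnit.unit_spec]

theorem continuousOn_blockUnit (hord : ∀ σ ∈ Λ.faces, IsChain (· ≤ ·) (σ : Set V))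
    (hπ : IsQuasiRep T.generators δ π) (hδ0 : 0 ≤ δ) (hδ : δ ≤ 1 / 16)
    (hδ' : Fintype.card V * (61 * δ) ≤ 1 / 2) {i j : V} (hij : i < j) :
    ContinuousOn (T.blockUnit π i j) (Λ.dualCell₂ i j) := by
  rw [Units.isOpenEmbedding_val.isInducing.continuousOn_iff]
  refine ((T.continuousOn_blockFun π Finset.univ i j).mono
    fun t ht => (dualCell_pos ht.1).ne').congr fun t ht => ?_
  exact val_blockUnit hord hπ hδ0 hδ hδ' hij ht.1 ht.2

/-- The bundle `β(π)` exists for every `(ℱ_Λ, δ)`-representation `π` with `δ` small, and its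
transition functions are close to the values of `π`. -/
theorem exists_isBeta (hord : ∀ σ ∈ Λ.faces, IsChain (· ≤ ·) (σ : Set V))
    (hπ : IsQuasiRep T.generators δ π) (hδ0 : 0 ≤ δ) (hδ : δ ≤ 1 / 16)
    (hδ' : Fintype.card V * (61 * δ) ≤ 1 / 2) :
    ∃ w : Λ.CoordBundle A, T.IsBeta π w ∧ ∀ (i j : V) (h : Λ.skeleton.Adj i j)
      (x : Λ.dualCell₂ i j),
      ‖(w.fn i j h x : A) - π (T.γ ⟨(i, j), h.2⟩)‖ ≤ (122 * Fintype.card V + 91) * δ := by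
  classical
  have hcmp : ∀ {i j : V}, Λ.skeleton.Adj i j → i < j ∨ j < i := by
    rintro i j ⟨hne, σ, hσ, hi, hj⟩
    rcases hord σ hσ hi hj hne with h | h
    · exact Or.inl (lt_of_le_of_ne h hne)
    · exact Or.inr (lt_of_le_of_ne h hne.symm)
  let F : V → V → (V → ℝ) → Aˣ := fun i j t =>
    if i < j then T.blockUnit π i j t else (T.blockUnit π j i t)⁻¹
  have hFlt : ∀ {i j : V} (t : V → ℝ), i < j → F i j t = T.blockUnit π i j t := fun t h => if_pos h
  have hFinv : ∀ {i j : V} (t : V → ℝ), Λ.skeleton.Adj i j → F i j t = (F j i t)⁻¹ := by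
    intro i j t h
    rcases hcmp h with h | h
    · simp only [F, if_pos h, if_neg h.asymm, inv_inv]
    · simp only [F, if_pos h, if_neg h.asymm]
  have hFc : ∀ i j : V, Λ.skeleton.Adj i j → ContinuousOn (F i j) (Λ.dualCell₂ i j) := by
    intro i j h
    rcases hcmp h with h | h
    · simpa only [F, if_pos h] using continuousOn_blockUnit hord hπ hδ0 hδ hδ' h
    · have hc := continuousOn_blockUnit hord hπ hδ0 hδ hδ' h
      rw [dualCell₂, Set.inter_comm] at hc
      simp only [F, if_neg h.asymm]
      exact hc.inv
  have hmul : ∀ {i j k : V} {t : V → ℝ}, i < j → j < k → t ∈ Λ.dualCell i → t ∈ Λ.dualCell j →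
      t ∈ Λ.dualCell k → F i k t = F i j t * F j k t := by
    intro i j k t hij hjk hi hj hk
    rw [hFlt t hij, hFlt t hjk, hFlt t (hij.trans hjk)]
    apply Units.ext
    rw [Units.val_mul, val_blockUnit hord hπ hδ0 hδ hδ' (hij.trans hjk) hi hk,
      val_blockUnit hord hπ hδ0 hδ hδ' hij hi hj, val_blockUnit hord hπ hδ0 hδ hδ' hjk hj hk,
      blockFun_eq_carrier (by simp), blockFun_eq_carrier (by simp) i j,
      blockFun_eq_carrier (by simp) j k]
    exact T.blockFun_mul_blockFun π (hord _ (carrier_mem_faces hi))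
      (mem_carrier_of_mem_dualCell hj) hij hjk (dualCell_pos hi).ne' (dualCell_eq hi hj)
  have hco : ∀ {i j k : V} {t : V → ℝ}, Λ.skeleton.Adj i j → Λ.skeleton.Adj j k →
      Λ.skeleton.Adj i k → t ∈ Λ.dualCell i → t ∈ Λ.dualCell j → t ∈ Λ.dualCell k →
      F i k t = F i j t * F j k t := by
    intro i j k t hij hjk hik hi hj hk
    -- All orders of `i`, `j`, `k` reduce to the increasing one by taking inverses.
    rcases hcmp hij with h1 | h1 <;> rcases hcmp hjk with h2 | h2 <;> rcases hcmp hik with h3 | h3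
    · exact hmul h1 h2 hi hj hk
    · exact absurd (h1.trans h2) h3.asymm
    · rw [hmul h3 h2 hi hk hj, hFinv t hjk]; group
    · rw [hFinv t hjk, hmul h3 h1 hk hi hj, hFinv t hik]; group
    · rw [hmul h1 h3 hj hi hk, hFinv t hij]; group
    · rw [hFinv t hij, hmul h2 h3 hj hk hi, hFinv t hik]; group
    · exact absurd (h2.trans h1) h3.asymm
    · rw [hFinv t hik, hmul h2 h1 hk hj hi, hFinv t hij, hFinv t hjk]; group
  let w : Λ.CoordBundle A :=
    { fn := fun i j h => ⟨fun x => F i j x.1, (hFc i j h).domRestrict⟩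
      inv_eq := fun i j h t _ _ => hFinv t h
      cocycle := fun i j k hij hjk hik _ t hi hj hk => hco hij hjk hik hi hj hk }
  refine ⟨w, ⟨?_, ?_⟩, ?_⟩
  · exact fun γ hγ => hπ.perturb_mem_unitary hδ hγ (T.inv_mem_generators hγ)
  · rintro i j h hij σ hσ hi hj x ⟨hx, -⟩
    change (F i j x.1 : A) = _
    rw [hFlt _ hij, val_blockUnit hord hπ hδ0 hδ hδ' hij x.2.1 x.2.2,
      blockFun_eq_carrier (by simp), blockFun_eq_carrier hx.2.1]
  · intro i j h x
    change ‖(F i j x.1 : A) - _‖ ≤ _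
    have h1 := norm_u_sub_le hπ hδ h.2
    have hN : (0 : ℝ) ≤ Fintype.card V * δ := by positivity
    rcases hcmp h with hij | hij
    · have h2 := norm_blockFun_univ_sub_le hord hπ hδ0 hδ hij x.2.1 x.2.2
      rw [hFlt _ hij, val_blockUnit hord hπ hδ0 hδ hδ' hij x.2.1 x.2.2]
      have := norm_sub_le_norm_sub_add_norm_sub (T.blockFun π Finset.univ i j x.1) (T.u π i j)
        (π (T.γ ⟨(i, j), h.2⟩) : A)
      linarith
    · have h2 := norm_blockFun_univ_sub_le hord hπ hδ0 hδ hij x.2.2 x.2.1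
      rw [← val_blockUnit hord hπ hδ0 hδ hδ' hij x.2.2 x.2.1] at h2
      have h3 := norm_inv_sub_star_le (u_mem_unitary hπ hδ h.2.symm) _ (h2.trans hδ')
      have h4 := norm_u_sub_star_le hπ hδ h.2
      rw [hFinv _ h, hFlt _ hij]
      rw [norm_sub_rev] at h4
      have h5 := norm_sub_le_norm_sub_add_norm_sub (((T.blockUnit π j i x.1)⁻¹ : Aˣ) : A)
        (star (T.u π j i)) (π (T.γ ⟨(i, j), h.2⟩) : A)
      have h6 := norm_sub_le_norm_sub_add_norm_sub (star (T.u π j i)) (T.u π i j)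
        (π (T.γ ⟨(i, j), h.2⟩) : A)
      linarith

end RootedTree

end Beta

/-! ### The two maps are approximately inverse to each other -/

section Inverse

variable {V : Type*} [Fintype V] {Λ : AbstractSimplicialComplex V}
variable {A : Type*} [CStarAlgebra A]

theorem CoordBundle.IsFlat.exists_unitary_norm_alongWalk_sub_lt {v : Λ.CoordBundle A} {ε : ℝ}
    (hv : v.IsFlat ε) (hε : 0 < ε) (e : Λ.Edge) :
    ∃ U ∈ unitary A, ‖(v.alongWalk e.walk : A) - U‖ < ε := by
  obtain ⟨⟨i, j⟩, hij⟩ := e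
  by_cases h : i = j
  · subst h
    refine ⟨1, one_mem _, ?_⟩
    rw [v.alongWalk_edge_walk_self hij]
    simpa using hε
  · rw [v.alongWalk_edge_walk ⟨h, hij⟩]
    exact exists_unitary_of_mem_nearUnitary (hv.near i j ⟨h, hij⟩ _)

/-- A bundle whose transition functions are close to the values of a quasi-representation is nearly
flat. -/
theorem CoordBundle.isFlat_of_norm_sub_le {T : Λ.RootedTree} {π : T.Γ → Aˣ} {δ D : ℝ}
    (hπ : IsQuasiRep T.generators δ π) (hδ : 0 < δ) (hD : 0 ≤ D) {w : Λ.CoordBundle A}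
    (hw : ∀ (i j : V) (h : Λ.skeleton.Adj i j) (x : Λ.dualCell₂ i j),
      ‖(w.fn i j h x : A) - π (T.γ ⟨(i, j), h.2⟩)‖ ≤ D * δ) :
    w.IsFlat ((2 * D + 2) * δ) := by
  have hDδ : 0 ≤ D * δ := mul_nonneg hD hδ.le
  refine ⟨fun i j h x => ?_, fun i j h x y => ?_⟩
  · obtain ⟨U, hU, hd⟩ := exists_unitary_of_mem_nearUnitary
      (hπ.near (T.γ ⟨(i, j), h.2⟩) ⟨_, rfl⟩)
    refine mem_nearUnitary_of_norm_sub_lt hU ?_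
    have := norm_sub_le_norm_sub_add_norm_sub (w.fn i j h x : A) (π (T.γ ⟨(i, j), h.2⟩)) U
    have := hw i j h x
    linarith
  · have h1 := norm_sub_le_norm_sub_add_norm_sub (w.fn i j h x : A) (π (T.γ ⟨(i, j), h.2⟩))
      (w.fn i j h y)
    have h2 := hw i j h x
    have h3 := hw i j h y
    rw [norm_sub_rev] at h3
    linarith

/-- The constants come from the finitely many generators, the tree paths and the number of vertices. -/
theorem exists_alpha_beta_constants [PartialOrder V]
    (hord : ∀ σ ∈ Λ.faces, IsChain (· ≤ ·) (σ : Set V))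
    (T : Λ.RootedTree) (s : T.Γ → FreeGroup Λ.Edge)
    (hs : ∀ γ : T.Γ, T.q (s γ) = γ) (hs1 : s 1 = 1) :
    ∃ C₁ ε₁ δ₁ : ℝ, 0 < C₁ ∧ 0 < ε₁ ∧ 0 < δ₁ ∧
      ∀ (A : Type u) [CStarAlgebra A],
        (∀ (ε : ℝ), 0 < ε → ε < ε₁ → ∀ v : Λ.CoordBundle A, v.IsNormalized T → v.IsFlat ε →
          ∃ w : Λ.CoordBundle A, T.IsBeta (v.alpha T s) w ∧ w.dist v ≤ C₁ * ε) ∧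
        (∀ (δ : ℝ), 0 < δ → δ < δ₁ → ∀ π : T.Γ → Aˣ, IsQuasiRep T.generators δ π →
          ∃ w : Λ.CoordBundle A, T.IsBeta π w ∧ T.repDist (w.alpha T s) π ≤ C₁ * δ) := by
  obtain ⟨C, hC, hα⟩ := T.exists_generator_bounds.{u} hs
  obtain ⟨L, hL, hlift⟩ := T.exists_norm_lift_of_sub_le.{u} 1
  obtain ⟨N, hN⟩ : ∃ N : ℝ, N = Fintype.card V := ⟨_, rfl⟩
  have hN0 : 0 ≤ N := hN ▸ Nat.cast_nonneg _
  -- `D * δ` bounds the distance from `β(π)` to `π`, and `Q * ε` the defect of `α(v)`.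
  obtain ⟨D, hD⟩ : ∃ D : ℝ, D = 122 * N + 91 := ⟨_, rfl⟩
  obtain ⟨Q, hQ⟩ : ∃ Q : ℝ, Q = C + L + 1 := ⟨_, rfl⟩
  have hD0 : 0 < D := by rw [hD]; positivity
  have hQ1 : 1 ≤ Q := by linarith
  have hB : 0 < Q * (2 * D + 2) := by positivity
  -- This bound on the defect of a quasi-representation guarantees that `β` is defined.
  have hsmall : ∀ {δ : ℝ}, 0 < δ → (2 * D + 2) * δ ≤ 1 →
      δ ≤ 1 / 16 ∧ Fintype.card V * (61 * δ) ≤ 1 / 2 := by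
    intro δ h0 h1
    rw [← hN]
    rw [hD] at h1
    have : 0 ≤ N * δ := by positivity
    constructor <;> linarith
  refine ⟨Q * (2 * D + 2), 1 / (Q * (2 * D + 2)), 1 / (Q * (2 * D + 2)), hB, by positivity,
    by positivity, fun A _ => ⟨?_, ?_⟩⟩
  · intro ε h0 h1 v hnorm hv
    rw [lt_div_iff₀ hB] at h1
    have hQε : 0 < Q * ε := by positivity
    have hε1 : ε ≤ 1 := by nlinarith
    obtain ⟨hα1, hα2⟩ := hα A v ε h0.le hε1 hv
    have hedge : ∀ e : Λ.Edge,
        ‖(v.alpha T s (T.γ e) : A) - v.alongWalk e.walk‖ ≤ (C + L) * ε := by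
      intro e
      have e1 := hlift A v ε h0.le hε1 hv (fun i j h => by
        rw [hnorm i j h, Units.val_one, sub_self, norm_zero]; positivity) e
      have := norm_sub_le_norm_sub_add_norm_sub (v.alpha T s (T.γ e) : A)
        (v.lift T (FreeGroup.of e)) (v.alongWalk e.walk)
      linarith [hα1 e]
    have hrep : IsQuasiRep T.generators (Q * ε) (v.alpha T s) := by
      refine ⟨?_, fun γ hγ γ' hγ' => ?_, ?_⟩
      · rintro _ ⟨e, rfl⟩
        obtain ⟨U, hU, hd⟩ := hv.exists_unitary_norm_alongWalk_sub_lt h0 e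
        refine mem_nearUnitary_of_norm_sub_lt hU ?_
        have := norm_sub_le_norm_sub_add_norm_sub (v.alpha T s (T.γ e) : A)
          (v.alongWalk e.walk) U
        rw [hQ]
        linarith [hedge e]
      · refine (hα2 γ hγ γ' hγ').trans_lt ?_
        rw [hQ]
        nlinarith
      · simp only [CoordBundle.alpha, hs1, map_one]
    obtain ⟨k1, k2⟩ := hsmall hQε (by nlinarith)
    obtain ⟨w, hw, hwπ⟩ := RootedTree.exists_isBeta hord hrep hQε.le k1 k2
    refine ⟨w, hw, Real.iSup_le (fun e => Real.iSup_le (fun x => ?_) (by positivity))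
      (by positivity)⟩
    have e1 := hwπ e.fst e.snd e.adj x
    have e2 := hedge ⟨(e.fst, e.snd), e.adj.2⟩
    rw [v.alongWalk_edge_walk e.adj] at e2
    have e3 := hv.flat e.fst e.snd e.adj ⟨_, edgeBarycenter_mem e.adj⟩ x
    change ‖(v.atBary e.adj : A) - _‖ < ε at e3
    rw [← hN, ← hD] at e1
    have e4 := norm_sub_le_norm_sub_add_norm_sub (w.fn e.fst e.snd e.adj x : A)
      (v.alpha T s (T.γ ⟨(e.fst, e.snd), e.adj.2⟩)) (v.fn e.fst e.snd e.adj x)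
    have e5 := norm_sub_le_norm_sub_add_norm_sub
      (v.alpha T s (T.γ ⟨(e.fst, e.snd), e.adj.2⟩) : A)
      (v.atBary e.adj) (v.fn e.fst e.snd e.adj x)
    have e6 : Q * ε = (C + L) * ε + ε := by rw [hQ]; ring
    have e7 : 0 ≤ D * (Q * ε) := by positivity
    linarith
  · intro δ h0 h1 π hπ
    rw [lt_div_iff₀ hB] at h1
    have hδ1 : (2 * D + 2) * δ ≤ 1 := by
      have : 0 ≤ (Q - 1) * ((2 * D + 2) * δ) := mul_nonneg (by linarith) (by positivity)
      nlinarith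
    obtain ⟨k1, k2⟩ := hsmall h0 hδ1
    obtain ⟨w, hw, hwπ⟩ := RootedTree.exists_isBeta hord hπ h0.le k1 k2
    rw [← hN, ← hD] at hwπ
    have hflat := CoordBundle.isFlat_of_norm_sub_le hπ h0 hD0.le hwπ
    have hε0 : 0 ≤ (2 * D + 2) * δ := by positivity
    refine ⟨w, hw, Real.iSup_le ?_ (by positivity)⟩
    rintro ⟨_, e, rfl⟩
    have e1 := (hα A w _ hε0 hδ1 hflat).1 e
    have e2 := hlift A w _ hε0 hδ1 hflat (fun i j h => by
      have := hwπ i j (T.le_skeleton h) ⟨_, edgeBarycenter_mem (T.le_skeleton h)⟩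
      rw [T.γ_of_tree_adj h, hπ.one, Units.val_one] at this
      refine this.trans ?_
      nlinarith) e
    have e3 : ‖(w.alongWalk e.walk : A) - π (T.γ e)‖ ≤ D * δ := by
      obtain ⟨⟨i, j⟩, hij⟩ := e
      by_cases h : i = j
      · subst h
        rw [w.alongWalk_edge_walk_self hij, T.γ_self hij, hπ.one, sub_self, norm_zero]
        positivity
      · rw [w.alongWalk_edge_walk ⟨h, hij⟩]
        exact hwπ i j ⟨h, hij⟩ _
    have e4 := norm_sub_le_norm_sub_add_norm_sub (w.alpha T s (T.γ e) : A)
      (w.lift T (FreeGroup.of e)) (π (T.γ e))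
    have e5 := norm_sub_le_norm_sub_add_norm_sub (w.lift T (FreeGroup.of e) : A)
      (w.alongWalk e.walk) (π (T.γ e))
    have e6 : Q * (2 * D + 2) * δ
        = C * ((2 * D + 2) * δ) + L * ((2 * D + 2) * δ) + (2 * D + 2) * δ := by rw [hQ]; ring
    have e7 : 0 ≤ D * δ := by positivity
    dsimp only
    linarith

end Inverse

end AbstractSimplicialComplex

end

open AbstractSimplicialComplex in
theorem theorem3p3 {V : Type*} [Fintype V] [PartialOrder V] (Λ : AbstractSimplicialComplex V)
    (hconn : Λ.skeleton.Connected)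
    (hord : ∀ σ ∈ Λ.faces, IsChain (· ≤ ·) (σ : Set V))
    (T : Λ.RootedTree) (s : T.Γ → FreeGroup Λ.Edge)
    (hs : ∀ γ : T.Γ, T.q (s γ) = γ) (hs1 : s 1 = 1) :
    ∃ C₁ ε₁ δ₁ : ℝ, 0 < C₁ ∧ 0 < ε₁ ∧ 0 < δ₁ ∧
      ∀ (A : Type*) [CStarAlgebra A],
        (∀ (ε : ℝ), 0 < ε → ε < ε₁ → ∀ v : Λ.CoordBundle A, v.IsNormalized T → v.IsFlat ε →
          ∃ w : Λ.CoordBundle A, T.IsBeta (v.alpha T s) w ∧ w.dist v ≤ C₁ * ε) ∧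
        (∀ (δ : ℝ), 0 < δ → δ < δ₁ → ∀ π : T.Γ → Aˣ, IsQuasiRep T.generators δ π →
          ∃ w : Λ.CoordBundle A, T.IsBeta π w ∧ T.repDist (w.alpha T s) π ≤ C₁ * δ) :=
  exists_alpha_beta_constants hord T s hs hs1
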